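/- **Setting.** Let $X$ be a topological space (for instance $X\subseteq\mathbb R^n$), $X_f\subseteq X$ the collision-free configurations, and $T\subseteq X_f$ a nonempty finite set of terminals. Let $c$ assign to every path in $X$ a cost in $[0,\infty]$ that is additive under concatenation (for instance its length). A local planner returns, for a pair $u,v$, a path in $X_f$ from $u$ to $v$ or fails; $dist(u,v)$ is the cost of that path ($\infty$ if it fails), and $dist(u,v)=dist(v,u)$. Let $h(u,v)\in[0,\infty)$ be a lower bound, symmetric in $u,v$, on the cost of every path in $X_f$ from $u$ to $v$ (for instance the Euclidean distance, when $c$ is the length), and let $\rho\ge 0$ be the connection radius. For a finite set $V\supseteq T$ the roadmap $G$ is the undirected graph on $V$ that joins distinct $u,v$ with $dist(u,v)\le\rho$, with edge cost $dist(u,v)$; $N_V(u)$ is the set of neighbours of $u$. The metric completion of $T$ in $G$ is the complete graph on $T$ in which $\{u,v\}$ has as cost $d_G(u,v)$ the minimum cost of a path from $u$ to $v$ in $G$ ($\infty$ if there is none). **The algorithm IST\*.** Initially $V=T$, $S_T=\emptyset$, $\mathcal A$ is the set of all unordered pairs of distinct terminals, every terminal $t$ has $g(t)=0$ and root $r_t=t$,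 every other point has $g=\infty$ and no root, and $cost_T(u,v)=dist(u,v)$ if $u,v\in T$ are joined by an edge of the initial roadmap, $cost_T(u,v)=\infty$ otherwise. Each iteration receives a finite batch $S'\subseteq X_f\setminus V$ of new samples and performs three steps. 1. *Ripple.* The samples are processed one by one, in any order. A sample $s$ is added to $V$. If no neighbour of $s$ has a root, nothing more is done for $s$. Otherwise choose a rooted neighbour $n^*$ that minimises $g(n)+dist(s,n)$; set $g(s)=g(n^*)+dist(s,n^*)$ and $r_s=r_{n^*}$, make $n^*$ the parent of $s$, and insert $s$ into a priority queue with key $g(s)$. While the queue is nonempty, extract an entry of minimum key, with node $u$, and for each $n\in N_V(u)$, in any order: if $g(u)+dist(u,n)<g(n)$, set $g(n)=g(u)+dist(u,n)$ and $r_n=r_u$, make $u$ the parent of $n$, and insert $n$ with key $g(n)$; otherwise, if $r_n\ne r_u$ and $d=g(n)+dist(n,u)+g(u)<cost_T(r_n,r_u)$, set $cost_T(r_n,r_u)=d$. 2. *UpdateTree.* If $S_T=\emptyset$, run Kruskal's algorithm on the pairs of terminals with finite $cost_T$; $S_T$ becomes the spanning tree of $T$ found, and stays $\emptyset$ if there is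 none. If $S_T\neq\emptyset$, go through the edges $e\in\mathcal A$ outside $S_T$, in any order. Let $P$ be the set of the edges other than $e$ of the cycle that $e$ closes with $S_T$, and $e^*$ an edge of $P$ of maximum $cost_T$. If $cost_T(e^*)>cost_T(e)$, replace $e^*$ by $e$ in $S_T$; otherwise, if $\sum_{e'\in P}cost_T(e')<cost_T(e)$, set $cost_T(e)$ to that sum. 3. *PruneEdges.* Remove from $\mathcal A$ every $e\notin S_T$ that closes a cycle with $S_T$ and for which $h(e)$ exceeds the maximum of $cost_T$ over the other edges of that cycle. Ties are broken arbitrarily, and the batches are arbitrary; in particular they may be drawn from any probability distribution that depends on the history. **Theorem.** At every iteration (the first or a later one), Ripple terminates, whatever choices are made, and the iteration can always be completed. At the end of the iteration $V$ consists of the terminals and all the points sampled so far. If the terminals lie in one connected component of the current roadmap $G=(V,E)$, then $S_T$ is a minimum spanning tree of the metric completion of $T$ in $G$, and $cost_T(e)=d_G(e)$ for every edge $e$ of $S_T$. -/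

import Mathlib

open scoped ENNReal NNReal

noncomputable section

namespace ISTStar

/-- An instance of the planning problem, together with the parameters of the planner. -/
structure Problem (X : Type*) [TopologicalSpace X] where
  /-- the obstacle-free configurations -/
  free : Set X
  /-- the cost of a path (for instance its length) -/
  pathCost : {u v : X} → Path u v → ℝ≥0∞
  /-- costs add up along concatenations -/
  pathCost_trans : ∀ {u v w : X} (σ : Path u v) (τ : Path v w),
    pathCost (σ.trans τ) = pathCost σ + pathCost τ
  /-- the local planner: a collision-free path between two configurations, or failure -/
  planner : (u v : X) → Option {σ : Path u v // ∀ t, σ t ∈ free}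
  /-- the roadmap is undirected: success and cost of the local planner are symmetric -/
  planner_comm : ∀ u v : X,
    (planner u v).elim ⊤ (fun σ => pathCost σ.1) = (planner v u).elim ⊤ (fun σ => pathCost σ.1)
  /-- the connection radius -/
  radius : ℝ≥0
  /-- the terminals -/
  T : Finset X
  T_nonempty : T.Nonempty
  T_free : ∀ t ∈ T, t ∈ free
  /-- the heuristic lower bound -/
  h : Sym2 X → ℝ≥0
  /-- `h` bounds from below the cost of every feasible path -/
  h_le : ∀ (u v : X) (σ : Path u v), (∀ t, σ t ∈ free) → (h s(u, v) : ℝ≥0∞) ≤ pathCost σ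

/-! ### Spanning trees on the terminals -/

open Classical in
/-- All unordered pairs of distinct terminals. -/
def termPairs {X : Type*} (T : Finset X) : Finset (Sym2 X) :=
  T.sym2.filter fun e => ¬ e.IsDiag

/-- `S` is the edge set of a tree with vertex set `T`. -/
def IsSpanningTree {X : Type*} (T : Finset X) (S : Finset (Sym2 X)) : Prop :=
  S ⊆ termPairs T ∧
    ((SimpleGraph.fromEdgeSet (S : Set (Sym2 X))).induce (T : Set X)).IsTree

/-- `S` is a minimum spanning tree of the complete graph on `T` with edge weights `w`. -/
def IsMST {X : Type*} (T : Finset X) (w : Sym2 X → ℝ≥0∞) (S : Finset (Sym2 X)) : Prop :=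
  IsSpanningTree T S ∧ ∀ S', IsSpanningTree T S' → ∑ e ∈ S, w e ≤ ∑ e ∈ S', w e

/-- The variables of the algorithm: the nodes `V` of the roadmap; for every node its cost-to-root
`g` (`⊤` if it has not been reached yet), its root and its parent (`none` is NULL); the priority
queue `Q` of nodes with keys; the batch `pending` of samples that still have to be inserted; the
terminal costs `costT`; the current tree `S` and the set `A` of active terminal edges. The edges of
the roadmap are determined by `V`, those of the shortest-path graph by `parent`. -/
structure State (X : Type*) where
  V : Finset X
  g : X → ℝ≥0∞
  root : X → Option X
  parent : X → Option X
  Q : Multiset (X × ℝ≥0∞)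
  pending : Finset X
  costT : Sym2 X → ℝ≥0∞
  S : Finset (Sym2 X)
  A : Finset (Sym2 X)

/-! ### Updating the tree -/

open Classical in
/-- One step of Kruskal's algorithm: the edge `e` is added unless it closes a cycle. -/
def kruskalAdd {X : Type*} (F : Finset (Sym2 X)) (e : Sym2 X) : Finset (Sym2 X) :=
  if ∃ u v, e = s(u, v) ∧ (SimpleGraph.fromEdgeSet (F : Set (Sym2 X))).Reachable u v then F
  else insert e F

open Classical in
/-- `S` is an outcome of Kruskal's algorithm for the edges of finite cost, scanned by
nondecreasing cost: the spanning tree that it finds, and `∅` if it finds none. -/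
def IsKruskal {X : Type*} (T : Finset X) (c : Sym2 X → ℝ≥0∞) (S : Finset (Sym2 X)) : Prop :=
  ∃ l : List (Sym2 X), l.Nodup ∧ (∀ e, e ∈ l ↔ e ∈ termPairs T ∧ c e < ⊤) ∧
    l.Pairwise (fun e f => c e ≤ c f) ∧
    S = if IsSpanningTree T (l.foldl kruskalAdd ∅) then l.foldl kruskalAdd ∅ else ∅

open Classical in
/-- `P` consists of the edges other than `e` of the cycle that `e` induces in the tree `S`. -/
def IsCycleRest {X : Type*} (S : Finset (Sym2 X)) (e : Sym2 X) (P : Finset (Sym2 X)) : Prop :=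
  ∃ (u v : X) (p : (SimpleGraph.fromEdgeSet (S : Set (Sym2 X))).Walk u v),
    e = s(u, v) ∧ p.IsPath ∧ P = p.edges.toFinset

/-- `f` is an edge of maximum cost in `P`. -/
def IsArgmax {X : Type*} (c : Sym2 X → ℝ≥0∞) (P : Finset (Sym2 X)) (f : Sym2 X) : Prop :=
  f ∈ P ∧ ∀ f' ∈ P, c f' ≤ c f

open Classical in
/-- The body of the loop of UpdateTree for the non-tree edge `e`, where `P` is the rest of the
cycle of `e` and `f` is an edge of maximum cost in `P`. -/
def exchange {X : Type*} (e : Sym2 X) (P : Finset (Sym2 X)) (f : Sym2 X)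
    (x : Finset (Sym2 X) × (Sym2 X → ℝ≥0∞)) : Finset (Sym2 X) × (Sym2 X → ℝ≥0∞) :=
  if x.2 e < x.2 f then (insert e (x.1.erase f), x.2)
  else if ∑ e' ∈ P, x.2 e' < x.2 e then (x.1, Function.update x.2 e (∑ e' ∈ P, x.2 e'))
  else x

/-- The loop of UpdateTree over a list of edges, on pairs (tree, terminal costs); edges that
belong to the tree when their turn comes are skipped. -/
inductive ExchangeLoop {X : Type*} : List (Sym2 X) →
    Finset (Sym2 X) × (Sym2 X → ℝ≥0∞) → Finset (Sym2 X) × (Sym2 X → ℝ≥0∞) → Prop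
  | nil (x) : ExchangeLoop [] x x
  | skip {e l x y} : e ∈ x.1 → ExchangeLoop l x y → ExchangeLoop (e :: l) x y
  | step {e l x y P f} : e ∉ x.1 → IsCycleRest x.1 e P → IsArgmax x.2 P f →
      ExchangeLoop l (exchange e P f x) y → ExchangeLoop (e :: l) x y

/-- UpdateTree: `y` is a possible new pair (tree, terminal costs). The active non-tree edges are
scanned in any order; edges that only leave the tree during the loop may be scanned or not. -/
def UpdateTree {X : Type*} (T : Finset X) (A : Finset (Sym2 X))
    (x y : Finset (Sym2 X) × (Sym2 X → ℝ≥0∞)) : Prop :=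
  (x.1 = ∅ ∧ IsKruskal T x.2 y.1 ∧ y.2 = x.2) ∨
  (x.1 ≠ ∅ ∧ ∃ l : List (Sym2 X), l.Nodup ∧ (∀ e ∈ l, e ∈ A) ∧ (∀ e ∈ A, e ∉ x.1 → e ∈ l) ∧
    ExchangeLoop l x y)

namespace Problem

variable {X : Type*} [TopologicalSpace X] (I : Problem X)

/-! ### The roadmap and the metric completion of the terminals -/

/-- The cost of the path found by the local planner, `⊤` if there is none. -/
def dist (u v : X) : ℝ≥0∞ := (I.planner u v).elim ⊤ fun σ => I.pathCost σ.1

/-- The cost of an undirected edge. -/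
def edgeCost : Sym2 X → ℝ≥0∞ := Sym2.lift ⟨I.dist, I.planner_comm⟩

open Classical in
/-- The neighbours of `u` in `V`. -/
def nbrs (V : Finset X) (u : X) : Finset X := V.filter fun v => v ≠ u ∧ I.dist u v ≤ I.radius

/-- The roadmap with node set `V`. (Points outside `V` are isolated.) -/
def roadmap (V : Finset X) : SimpleGraph X where
  Adj u v := u ∈ V ∧ v ∈ I.nbrs V u
  symm := ⟨by
    intro u v huv
    simp only [nbrs, Finset.mem_filter] at huv ⊢
    refine ⟨huv.2.1, huv.1, huv.2.2.1.symm, ?_⟩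
    have hc : I.dist u v = I.dist v u := I.planner_comm u v
    exact hc ▸ huv.2.2.2⟩
  loopless := ⟨by
    intro u hu
    simp [nbrs] at hu⟩

/-- The cost of a walk in the roadmap. -/
def walkCost {V : Finset X} {u v : X} (p : (I.roadmap V).Walk u v) : ℝ≥0∞ :=
  (p.edges.map I.edgeCost).sum

/-- The edge costs of the metric completion: the minimum cost of a path between the two end
points in the roadmap with node set `V` (`⊤` if there is no path). -/
def metricCompletion (V : Finset X) : Sym2 X → ℝ≥0∞ :=
  Sym2.lift ⟨fun u v => ⨅ p : (I.roadmap V).Walk u v, I.walkCost p, by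
    have key : ∀ u v : X, (⨅ p : (I.roadmap V).Walk u v, I.walkCost p) ≤
        ⨅ p : (I.roadmap V).Walk v u, I.walkCost p := by
      intro u v
      refine le_iInf fun p => (iInf_le _ p.reverse).trans (le_of_eq ?_)
      simp [walkCost, List.sum_reverse]
    exact fun u v => le_antisymm (key u v) (key v u)⟩

/-! ### The algorithm -/

open Classical in
/-- The initial state. Two terminals that are joined by an edge of the initial roadmap start with
the cost of that edge, all others with `⊤`. -/
def init : State X where
  V := I.T
  g u := if u ∈ I.T then 0 else ⊤
  root u := if u ∈ I.T then some u else none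
  parent u := if u ∈ I.T then some u else none
  Q := 0
  pending := ∅
  costT e := if e ∈ (I.roadmap I.T).edgeSet then I.edgeCost e else ⊤
  S := ∅
  A := termPairs I.T

open Classical in
/-- Ripple: the neighbour `n` of the extracted node `u` is scanned. -/
def scan (u : X) (st : State X) (n : X) : State X :=
  if st.g u + I.dist u n < st.g n then
    { st with
      g := Function.update st.g n (st.g u + I.dist u n)
      Q := (n, st.g u + I.dist u n) ::ₘ st.Q
      root := Function.update st.root n (st.root u)
      parent := Function.update st.parent n (some u) }
  else
    match st.root n, st.root u with
    | some a, some b =>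
      if a ≠ b ∧ st.g n + I.dist n u + st.g u < st.costT s(a, b) then
        { st with costT := Function.update st.costT s(a, b) (st.g n + I.dist n u + st.g u) }
      else st
    | _, _ => st

open Classical in
/-- Ripple, inner loop: an entry of minimum key is extracted from the queue, and the neighbours of
its node are scanned in some order. -/
def Expand (st st' : State X) : Prop :=
  ∃ (u : X) (k : ℝ≥0∞) (l : List X),
    (u, k) ∈ st.Q ∧ (∀ q ∈ st.Q, k ≤ q.2) ∧
    l.Nodup ∧ (∀ n, n ∈ l ↔ n ∈ I.nbrs st.V u) ∧
    st' = l.foldl (I.scan u) { st with Q := st.Q.erase (u, k) }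

open Classical in
/-- The sample `s` becomes a node of the roadmap that is not yet rooted. -/
def addNode (s : X) (st : State X) : State X :=
  { st with
    V := insert s st.V
    pending := st.pending.erase s
    root := Function.update st.root s none
    parent := Function.update st.parent s none }

open Classical in
/-- The node `s` is attached to its neighbour `n`, and inserted into the queue. -/
def attach (s n : X) (st : State X) : State X :=
  { st with
    g := Function.update st.g s (st.g n + I.dist s n)
    root := Function.update st.root s (st.root n)
    parent := Function.update st.parent s (some n)
    Q := (s, st.g n + I.dist s n) ::ₘ st.Q }

/-- Ripple, outer loop: some pending sample `s` is inserted into the roadmap, and attached to the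
best one of its rooted neighbours if there is a rooted neighbour. -/
def Pop (st st' : State X) : Prop :=
  st.Q = 0 ∧ ∃ s ∈ st.pending,
    ((∀ n ∈ I.nbrs (addNode s st).V s, (addNode s st).root n = none) ∧ st' = addNode s st) ∨
    (∃ n ∈ I.nbrs (addNode s st).V s, (addNode s st).root n ≠ none ∧
      (∀ m ∈ I.nbrs (addNode s st).V s, (addNode s st).root m ≠ none →
        st.g n + I.dist s n ≤ st.g m + I.dist s m) ∧
      st' = I.attach s n (addNode s st))

/-- One step of Ripple. -/
def RippleStep (st st' : State X) : Prop := I.Expand st st' ∨ I.Pop st st'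

/-- Ripple is over: the queue is empty and all samples have been inserted. -/
def RippleDone (st : State X) : Prop := st.Q = 0 ∧ st.pending = ∅

/-- PruneEdges removes `e`: its lower bound exceeds the maximum cost in the rest of its cycle. -/
def Prunable (S : Finset (Sym2 X)) (c : Sym2 X → ℝ≥0∞) (e : Sym2 X) : Prop :=
  e ∉ S ∧ ∃ P f, IsCycleRest S e P ∧ IsArgmax c P f ∧ c f < I.h e

open Classical in
/-- The part of an iteration after Ripple: UpdateTree and then PruneEdges. -/
def UpdatePrune (st st' : State X) : Prop :=
  ∃ y : Finset (Sym2 X) × (Sym2 X → ℝ≥0∞), UpdateTree I.T st.A (st.S, st.costT) y ∧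
    st' = { st with S := y.1, costT := y.2, A := st.A.filter fun e => ¬ I.Prunable y.1 y.2 e }

/-- The state in which Ripple starts on the batch `B`. -/
def load (B : Finset X) (st : State X) : State X := { st with pending := B }

/-- One complete iteration of the main loop, in which the batch `B` is sampled. -/
def Iteration (B : Finset X) (st st' : State X) : Prop :=
  ∃ τ, Relation.ReflTransGen I.RippleStep (load B st) τ ∧ RippleDone τ ∧ I.UpdatePrune τ st'

/-- `B` is a possible batch of samples: new collision-free configurations. -/
def IsBatch (B : Finset X) (st : State X) : Prop :=
  (∀ s ∈ B, s ∈ I.free) ∧ Disjoint B st.V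

/-- The states in which the main loop can be between two iterations. -/
inductive Reachable : State X → Prop
  | init : Reachable I.init
  | iterate {st st' : State X} {B : Finset X} :
      Reachable st → I.IsBatch B st → I.Iteration B st st' → Reachable st'

end Problem

end ISTStar

end

/-! Write `D` for the costs of the metric completion in the current roadmap and `c` for `costT`.
Always `D ≤ c`, because each finite terminal cost is bounded below by that of a route in the roadmap
(`Sound`). The theorem comes down to the reverse inequality on bottlenecks: if removing an edge `f`
of the tree separates terminals `u` and `v`, then `c f ≤ D s(u, v)`. Applied to all pairs this makes
the tree a minimum spanning tree for `D`, and applied to the ends of `f` itself it gives `c f = D f`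
(`isMST_of_bottleneck`).

The bottleneck bound has two halves. When the queue is empty, every roadmap edge is relaxed, so `g`
is at most the cost of any walk to a terminal. Along a walk `p` between terminals the roots pass
from one end to the other. Where they change, on an edge `xz`, the cost of the pair of roots is at
most `g x + dist x z + g z`: prefix, edge and suffix of `p`, hence at most the cost of `p`. So the
ends of `p` are linked by terminal pairs no more expensive than `p` (`RippleInv.conn_of_walk`). The
second half is that UpdateTree settles every terminal pair: its ends are joined in the tree by edges
no more expensive than the pair. Kruskal achieves this at once (`kruskal_foldl`), and each exchange
settles its own edge while keeping all earlier bottleneck bounds (`improves_exchange`). A pruned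
pair stays settled, since its bottleneck was below `h`, bottlenecks never grow, and `h ≤ D ≤ c` in
every later roadmap. Combining the halves, a tree edge dearer than `p` cannot separate the ends of
`p`.

Ripple terminates because `g` takes values among the finite sums of finitely many edge costs, a
well-founded set; each step lowers the number of pending samples, the function `g` or the queue size
lexicographically (`RippleInv.acc`). -/

namespace ISTStar

/-! ### Forests, spanning trees and a cut criterion for minimality. -/

section Forests

open Classical

variable {X : Type*}

/-- `u` and `v` are connected by edges in `F`. -/
def Conn (F : Finset (Sym2 X)) (u v : X) : Prop :=
  (SimpleGraph.fromEdgeSet (F : Set (Sym2 X))).Reachable u v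

/-- No edge of `F` connects two points that are connected by the other edges. -/
def Indep (F : Finset (Sym2 X)) : Prop :=
  ∀ u v, s(u, v) ∈ F → ¬ Conn (F.erase s(u, v)) u v

namespace Conn

variable {F G : Finset (Sym2 X)} {u v w a b : X}

theorem refl (u : X) : Conn F u u := SimpleGraph.Reachable.refl u

theorem symm (h : Conn F u v) : Conn F v u := SimpleGraph.Reachable.symm h

theorem trans (h : Conn F u v) (h' : Conn F v w) : Conn F u w := SimpleGraph.Reachable.trans h h'

theorem of_mem (h : s(u, v) ∈ F) : Conn F u v := by
  by_cases huv : u = v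
  · exact huv ▸ refl u
  · exact SimpleGraph.Adj.reachable (by simpa using ⟨h, huv⟩)

/-- Induction on a walk, packaged so that the other facts on connectivity need not mention walks. -/
theorem lift {r : X → X → Prop} (h : Conn F u v) (hr : ∀ x, r x x)
    (hs : ∀ x y z, s(x, y) ∈ F → r y z → r x z) : r u v := by
  obtain ⟨p⟩ := h
  induction p with
  | nil => exact hr _
  | cons hadj p ih => exact hs _ _ _ (by simpa using hadj.1) ih

theorem bind (h : Conn F u v) (hs : ∀ x y, s(x, y) ∈ F → Conn G x y) : Conn G u v :=
  h.lift refl fun x y _ hxy hyz => (hs x y hxy).trans hyz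

theorem mono (h : Conn F u v) (hFG : F ⊆ G) : Conn G u v :=
  h.bind fun _ _ hxy => of_mem (hFG hxy)

theorem of_empty (h : Conn (∅ : Finset (Sym2 X)) u v) : u = v :=
  h.lift (fun _ => rfl) (by simp)

theorem insert_cases (h : Conn (insert s(a, b) F) u v) :
    Conn F u v ∨ (Conn F u a ∧ Conn F b v) ∨ (Conn F u b ∧ Conn F a v) := by
  refine h.lift (r := fun u v => Conn F u v ∨ (Conn F u a ∧ Conn F b v) ∨
    (Conn F u b ∧ Conn F a v)) (fun x => .inl (refl x)) ?_
  intro x y z hxy ih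
  rcases Finset.mem_insert.1 hxy with hxy | hxy
  · rcases Sym2.eq_iff.1 hxy with ⟨rfl, rfl⟩ | ⟨rfl, rfl⟩
    · rcases ih with h | h | h
      · exact .inr (.inl ⟨refl _, h⟩)
      · exact .inr (.inl ⟨refl _, h.2⟩)
      · exact .inl h.2
    · rcases ih with h | h | h
      · exact .inr (.inr ⟨refl _, h⟩)
      · exact .inl h.2
      · exact .inr (.inr ⟨refl _, h.2⟩)
  · have hx := of_mem hxy
    rcases ih with h | h | h
    · exact .inl (hx.trans h)
    · exact .inr (.inl ⟨hx.trans h.1, h.2⟩)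
    · exact .inr (.inr ⟨hx.trans h.1, h.2⟩)

/-- If removing `s(a, b)` separates `u` from `v`, then adding `s(u, v)` reconnects `a` and `b`. -/
theorem exchange (h : Conn F u v) (hab : s(a, b) ∈ F) (hF : ¬ Conn (F.erase s(a, b)) u v) :
    Conn (insert s(u, v) (F.erase s(a, b))) a b := by
  rw [← Finset.insert_erase hab] at h
  have hsub := Finset.subset_insert s(u, v) (F.erase s(a, b))
  have huv : Conn (insert s(u, v) (F.erase s(a, b))) u v := of_mem (Finset.mem_insert_self _ _)
  rcases h.insert_cases with h | h | h
  · exact absurd h hF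
  · exact ((h.1.mono hsub).symm.trans huv).trans (h.2.mono hsub).symm
  · exact (h.2.mono hsub).trans (huv.symm.trans (h.1.mono hsub))

end Conn

variable {F S S' : Finset (Sym2 X)} {T : Finset X}

theorem Indep.mono {G : Finset (Sym2 X)} (hG : Indep G) (h : F ⊆ G) : Indep F :=
  fun u v huv hc => hG u v (h huv) (hc.mono (Finset.erase_subset_erase _ h))

/-- If an old edge became redundant, the detour around it would use the new edge; closing this
detour up with the old edge would connect `u` and `v` inside `F`. -/
theorem Indep.insert {u v : X} (hF : Indep F) (huv : ¬ Conn F u v) :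
    Indep (insert s(u, v) F) := by
  intro x y hxy hc
  have hmem : s(u, v) ∉ F := fun h => huv (Conn.of_mem h)
  by_cases heq : s(x, y) = s(u, v)
  · rw [heq, Finset.erase_insert hmem] at hc
    rcases Sym2.eq_iff.1 heq with ⟨rfl, rfl⟩ | ⟨rfl, rfl⟩
    · exact huv hc
    · exact huv hc.symm
  · have hxyF : s(x, y) ∈ F := (Finset.mem_insert.1 hxy).resolve_left heq
    rw [Finset.erase_insert_of_ne (Ne.symm heq)] at hc
    have hsub := Finset.erase_subset s(x, y) F
    have hxyc : Conn F x y := Conn.of_mem hxyF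
    rcases hc.insert_cases with h | h | h
    · exact hF x y hxyF h
    · exact huv (((h.1.mono hsub).symm.trans hxyc).trans (h.2.mono hsub).symm)
    · exact huv ((h.2.mono hsub).trans (hxyc.symm.trans (h.1.mono hsub)))

theorem fromEdgeSet_erase (F : Finset (Sym2 X)) (e : Sym2 X) :
    SimpleGraph.fromEdgeSet ((F.erase e : Finset (Sym2 X)) : Set (Sym2 X)) =
      (SimpleGraph.fromEdgeSet (F : Set (Sym2 X))).deleteEdges {e} := by
  ext x y
  simp only [SimpleGraph.fromEdgeSet_adj, SimpleGraph.deleteEdges_adj, Finset.coe_erase,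
    Set.mem_sdiff, Set.mem_singleton_iff]
  tauto

theorem Indep.isAcyclic (hF : Indep F) :
    (SimpleGraph.fromEdgeSet (F : Set (Sym2 X))).IsAcyclic := by
  rw [SimpleGraph.isAcyclic_iff_forall_adj_isBridge]
  intro u v huv
  rw [SimpleGraph.isBridge_iff, ← fromEdgeSet_erase]
  exact hF u v (by simpa using huv.1)

theorem indep_of_isAcyclic (hF : ∀ e ∈ F, ¬ e.IsDiag)
    (h : (SimpleGraph.fromEdgeSet (F : Set (Sym2 X))).IsAcyclic) : Indep F := by
  rw [SimpleGraph.isAcyclic_iff_forall_adj_isBridge] at h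
  intro u v huv
  have := h (v := u) (w := v) (by simpa using ⟨huv, hF _ huv⟩)
  rwa [SimpleGraph.isBridge_iff, ← fromEdgeSet_erase] at this

/-- In a forest, removing an edge of the path between two points separates them. -/
theorem Indep.not_conn_erase {u v : X} (hF : Indep F)
    {p : (SimpleGraph.fromEdgeSet (F : Set (Sym2 X))).Walk u v} (hp : p.IsPath) {f : Sym2 X}
    (hf : f ∈ p.edges) : ¬ Conn (F.erase f) u v := by
  rintro ⟨q⟩
  have hle : SimpleGraph.fromEdgeSet ((F.erase f : Finset (Sym2 X)) : Set (Sym2 X)) ≤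
      SimpleGraph.fromEdgeSet (F : Set (Sym2 X)) :=
    SimpleGraph.fromEdgeSet_mono (by simp)
  have hq : (q.toPath.1.mapLe hle).IsPath := q.toPath.2.mapLe hle
  -- Paths in a forest are unique, so a path avoiding `f` would have to be `p`, which contains `f`.
  have heq := congrArg Subtype.val ((hF.isAcyclic.subsingleton_path u v).elim ⟨p, hp⟩ ⟨_, hq⟩)
  simp only at heq
  rw [heq, SimpleGraph.Walk.edges_mapLe_eq_edges] at hf
  have := q.toPath.1.edges_subset_edgeSet hf
  simp only [SimpleGraph.edgeSet_fromEdgeSet, Set.mem_sdiff, Finset.coe_erase] at this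
  exact this.1.2 rfl

theorem mem_termPairs {u v : X} : s(u, v) ∈ termPairs T ↔ u ∈ T ∧ v ∈ T ∧ u ≠ v := by
  simp [termPairs, and_assoc]

theorem Conn.mem_of_subset_termPairs {u v : X} (hS : S ⊆ termPairs T) (h : Conn S u v)
    (hu : u ∈ T) : v ∈ T :=
  h.lift (r := fun u v => u ∈ T → v ∈ T) (fun _ => id)
    (fun _ _ _ hxy ih _ => ih (mem_termPairs.1 (hS hxy)).2.1) hu

/-- Spanning trees in terms of connectivity. -/
theorem isSpanningTree_iff (hT : T.Nonempty) :
    IsSpanningTree T S ↔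
      S ⊆ termPairs T ∧ (∀ u ∈ T, ∀ v ∈ T, Conn S u v) ∧ Indep S := by
  refine and_congr_right fun hS => ?_
  have hdiag : ∀ e ∈ S, ¬ e.IsDiag := fun e he => (Finset.mem_filter.1 (hS he)).2
  have hsupp : ∀ {u v : X} (p : (SimpleGraph.fromEdgeSet (S : Set (Sym2 X))).Walk u v),
      u ∈ T → ∀ w ∈ p.support, w ∈ T := by
    intro u v p hu w hw
    exact Conn.mem_of_subset_termPairs hS ⟨p.takeUntil w hw⟩ hu
  have hne : Nonempty (T : Set X) := hT.to_subtype
  constructor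
  · intro h
    refine ⟨fun u hu v hv => ?_, ?_⟩
    · exact (h.connected.preconnected ⟨u, hu⟩ ⟨v, hv⟩).map
        (SimpleGraph.Embedding.induce (T : Set X)).toHom
    · refine indep_of_isAcyclic hdiag ?_
      intro u c hc
      have hu : u ∈ T := by
        cases c with
        | nil => exact absurd rfl hc.ne_nil
        | cons hadj _ => exact (mem_termPairs.1 (hS (by simpa using hadj.1))).1
      have hmap := c.map_induce (s := (T : Set X)) (hsupp c hu)
      refine h.isAcyclic (c.induce (T : Set X) (hsupp c hu)) ?_
      refine (SimpleGraph.Walk.isCycle_map_iff_of_injective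
        (f := (SimpleGraph.Embedding.induce (G := SimpleGraph.fromEdgeSet (S : Set (Sym2 X)))
          (T : Set X)).toHom) Subtype.val_injective).1 ?_
      rw [hmap]
      exact hc
  · rintro ⟨hconn, hind⟩
    refine ⟨⟨?_⟩, hind.isAcyclic.induce _⟩
    rintro ⟨u, hu⟩ ⟨v, hv⟩
    obtain ⟨p⟩ := hconn u hu v hv
    exact ⟨p.induce _ (hsupp p hu)⟩

/-- The exchange property of spanning trees. -/
theorem IsSpanningTree.exchange (hT : T.Nonempty) (hS : IsSpanningTree T S) {u v : X} {f : Sym2 X}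
    (huv : s(u, v) ∈ termPairs T) (hf : f ∈ S) (hsep : ¬ Conn (S.erase f) u v) :
    IsSpanningTree T (insert s(u, v) (S.erase f)) := by
  rw [isSpanningTree_iff hT] at hS ⊢
  obtain ⟨hsub, hconn, hind⟩ := hS
  refine ⟨?_, ?_, (hind.mono (Finset.erase_subset _ _)).insert hsep⟩
  · exact Finset.insert_subset huv ((Finset.erase_subset _ _).trans hsub)
  · intro x hx y hy
    refine (hconn x hx y hy).bind fun a b hab => ?_
    by_cases habf : s(a, b) = f
    · subst habf
      have := mem_termPairs.1 huv
      exact (hconn u this.1 v this.2.1).exchange hf hsep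
    · exact Conn.of_mem (Finset.mem_insert_of_mem (Finset.mem_erase.2 ⟨habf, hab⟩))

theorem IsSpanningTree.eq_of_subset (hT : T.Nonempty) (hS : IsSpanningTree T S)
    (hS' : IsSpanningTree T S') (h : S' ⊆ S) : S' = S := by
  rw [isSpanningTree_iff hT] at hS hS'
  refine h.antisymm fun e he => ?_
  induction e with | _ u v
  by_contra hne
  have huv := mem_termPairs.1 (hS.1 he)
  exact hS.2.2 u v he ((hS'.2.1 u huv.1 v huv.2.1).mono
    fun f hf => Finset.mem_erase.2 ⟨fun h' => hne (h' ▸ hf), h hf⟩)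

/-- A spanning tree is minimum if the end points of every terminal pair are connected in it by
edges that are not more expensive than the pair. -/
theorem isMST_of_conn (hT : T.Nonempty) {w : Sym2 X → ℝ≥0∞} (hS : IsSpanningTree T S)
    (hw : ∀ u v, s(u, v) ∈ termPairs T → Conn (S.filter fun f => w f ≤ w s(u, v)) u v) :
    IsMST T w S := by
  refine ⟨hS, fun S' hS' => ?_⟩
  -- `S'` is transformed into `S` by swaps that do not raise the weight, each removing an edge
  -- outside `S`.
  induction hn : (S' \ S).card using Nat.strong_induction_on generalizing S' with
  | _ n ih =>
    by_cases hsub : S' ⊆ S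
    · rw [hS.eq_of_subset hT hS' hsub]
    obtain ⟨e, he, heS⟩ := Finset.not_subset.1 hsub
    induction e with | _ u v
    have hS'i := (isSpanningTree_iff hT).1 hS'
    have hSi := (isSpanningTree_iff hT).1 hS
    have hsep := hS'i.2.2 u v he
    -- Deleting `s(u, v)` cuts `S'` in two; the cheap connection of `u` and `v` in `S` must cross
    -- this cut somewhere.
    obtain ⟨a, b, hab, hwab, hcab⟩ : ∃ a b, s(a, b) ∈ S ∧ w s(a, b) ≤ w s(u, v) ∧
        ¬ Conn (S'.erase s(u, v)) a b := by
      by_contra! hcon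
      refine hsep ((hw u v (hS'i.1 he)).bind fun a b hab => ?_)
      rw [Finset.mem_filter] at hab
      exact hcon a b hab.1 hab.2
    have habS' : s(a, b) ∉ S'.erase s(u, v) := fun h => hcab (Conn.of_mem h)
    have hS'' := hS'.exchange hT (hSi.1 hab) he hcab
    have hcard : (insert s(a, b) (S'.erase s(u, v)) \ S).card < n := by
      rw [← hn]
      refine Finset.card_lt_card ⟨fun f hf => ?_, fun h => ?_⟩
      · simp only [Finset.mem_sdiff, Finset.mem_insert, Finset.mem_erase] at hf ⊢
        rcases hf with ⟨rfl | hf, hfS⟩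
        · exact absurd hab hfS
        · exact ⟨hf.2, hfS⟩
      · have := h (Finset.mem_sdiff.2 ⟨he, heS⟩)
        simp only [Finset.mem_sdiff, Finset.mem_insert, Finset.mem_erase] at this
        rcases this.1 with h | h
        · exact heS (h ▸ hab)
        · exact h.1 rfl
    refine (ih _ hcard _ hS'' rfl).trans ?_
    rw [Finset.sum_insert habS', ← Finset.add_sum_erase S' w he]
    gcongr

end Forests

/-! ### Kruskal's algorithm and the exchange loop, in terms of bottlenecks. -/

section Update

open Classical

variable {X : Type*} {T : Finset X} {S P : Finset (Sym2 X)} {c : Sym2 X → ℝ≥0∞} {w : ℝ≥0∞}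
  {e f : Sym2 X}

/-- The end points of `e` are connected by edges of `S` that cost at most `w`. -/
def ConnLE (S : Finset (Sym2 X)) (c : Sym2 X → ℝ≥0∞) (w : ℝ≥0∞) (e : Sym2 X) : Prop :=
  ∀ u v, e = s(u, v) → Conn (S.filter fun f => c f ≤ w) u v

theorem connLE_mk {u v : X} : ConnLE S c w s(u, v) ↔ Conn (S.filter fun f => c f ≤ w) u v := by
  refine ⟨fun h => h u v rfl, fun h x y hxy => ?_⟩
  rcases Sym2.eq_iff.1 hxy with ⟨rfl, rfl⟩ | ⟨rfl, rfl⟩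
  exacts [h, h.symm]

theorem ConnLE.of_mem (h : e ∈ S) (hw : c e ≤ w) : ConnLE S c w e := by
  rintro u v rfl
  exact Conn.of_mem (Finset.mem_filter.2 ⟨h, hw⟩)

theorem ConnLE.bind {S' : Finset (Sym2 X)} {c' : Sym2 X → ℝ≥0∞} {w' : ℝ≥0∞} (h : ConnLE S c w e)
    (hS : ∀ f ∈ S, c f ≤ w → ConnLE S' c' w' f) : ConnLE S' c' w' e := by
  intro u v he
  refine (h u v he).bind fun x y hxy => ?_
  rw [Finset.mem_filter] at hxy
  exact hS _ hxy.1 hxy.2 x y rfl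

theorem ConnLE.mono {S' : Finset (Sym2 X)} {c' : Sym2 X → ℝ≥0∞} {w' : ℝ≥0∞} (h : ConnLE S c w e)
    (hS : S ⊆ S') (hc : ∀ f ∈ S, c' f ≤ c f) (hw : w ≤ w') : ConnLE S' c' w' e :=
  h.bind fun f hf hfw => .of_mem (hS hf) (((hc f hf).trans hfw).trans hw)

theorem ConnLE.of_subset (h : ∀ u v, e = s(u, v) → Conn P u v) (hP : P ⊆ S)
    (hc : ∀ f ∈ P, c f ≤ w) : ConnLE S c w e :=
  fun u v he => (h u v he).mono fun f hf => Finset.mem_filter.2 ⟨hP hf, hc f hf⟩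

/-- `e` is not cheaper than the bottleneck of the connection of its end points in the tree. -/
def Settled (x : Finset (Sym2 X) × (Sym2 X → ℝ≥0∞)) (e : Sym2 X) : Prop :=
  ConnLE x.1 x.2 (x.2 e) e

theorem IsCycleRest.subset (h : IsCycleRest S e P) : P ⊆ S := by
  obtain ⟨u, v, p, rfl, hp, rfl⟩ := h
  intro f hf
  have := p.edges_subset_edgeSet (List.mem_toFinset.1 hf)
  rw [SimpleGraph.edgeSet_fromEdgeSet] at this
  exact this.1

theorem walk_conn {G : SimpleGraph X} {u v : X} (p : G.Walk u v) : Conn p.edges.toFinset u v := by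
  induction p with
  | nil => exact Conn.refl _
  | cons hadj p ih =>
    simp only [SimpleGraph.Walk.edges_cons, List.toFinset_cons]
    exact (Conn.of_mem (Finset.mem_insert_self _ _)).trans
      (ih.mono (Finset.subset_insert _ _))

theorem IsCycleRest.conn (h : IsCycleRest S e P) : ∀ u v, e = s(u, v) → Conn P u v := by
  obtain ⟨u, v, p, rfl, hp, rfl⟩ := h
  intro x y hxy
  rcases Sym2.eq_iff.1 hxy with ⟨rfl, rfl⟩ | ⟨rfl, rfl⟩
  exacts [walk_conn p, (walk_conn p).symm]

theorem IsCycleRest.connLE (h : IsCycleRest S e P) (hf : IsArgmax c P f) : ConnLE S c (c f) e :=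
  .of_subset h.conn h.subset hf.2

theorem IsCycleRest.not_conn_erase (h : IsCycleRest S e P) (hS : Indep S) (hf : f ∈ P) :
    ∀ u v, e = s(u, v) → ¬ Conn (S.erase f) u v := by
  obtain ⟨u, v, p, rfl, hp, rfl⟩ := h
  have := hS.not_conn_erase hp (List.mem_toFinset.1 hf)
  intro x y hxy hc
  rcases Sym2.eq_iff.1 hxy with ⟨rfl, rfl⟩ | ⟨rfl, rfl⟩
  exacts [this hc, this hc.symm]

theorem IsSpanningTree.exists_isCycleRest (hT : T.Nonempty) (hS : IsSpanningTree T S)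
    (he : e ∈ termPairs T) : ∃ P, IsCycleRest S e P := by
  induction e with | _ u v
  have huv := mem_termPairs.1 he
  obtain ⟨p⟩ := ((isSpanningTree_iff hT).1 hS).2.1 u huv.1 v huv.2.1
  exact ⟨_, u, v, p.toPath, rfl, p.toPath.2, rfl⟩

theorem IsCycleRest.exists_isArgmax (hP : IsCycleRest S e P) (he : e ∈ termPairs T)
    (c : Sym2 X → ℝ≥0∞) : ∃ f, IsArgmax c P f := by
  refine Finset.exists_max_image P c (Finset.nonempty_iff_ne_empty.2 ?_)
  rintro rfl
  induction e with | _ u v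
  exact (mem_termPairs.1 he).2.2 (hP.conn u v rfl).of_empty

/-- `D` behaves like a distance. -/
structure IsDist (D : Sym2 X → ℝ≥0∞) : Prop where
  self : ∀ u, D s(u, u) = 0
  triangle : ∀ u v w, D s(u, w) ≤ D s(u, v) + D s(v, w)

theorem IsDist.le_walk {D : Sym2 X → ℝ≥0∞} (hD : IsDist D) (hc : ∀ e, D e ≤ c e)
    {G : SimpleGraph X} {u v : X} (p : G.Walk u v) : D s(u, v) ≤ (p.edges.map c).sum := by
  induction p with
  | nil => simp [hD.self]
  | cons hadj p ih =>
    simp only [SimpleGraph.Walk.edges_cons, List.map_cons, List.sum_cons]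
    exact (hD.triangle _ _ _).trans (add_le_add (hc _) ih)

theorem IsCycleRest.dist_le {D : Sym2 X → ℝ≥0∞} (hD : IsDist D) (hc : ∀ e, D e ≤ c e)
    (hP : IsCycleRest S e P) : D e ≤ ∑ e' ∈ P, c e' := by
  obtain ⟨u, v, p, rfl, hp, rfl⟩ := hP
  rw [List.sum_toFinset c hp.isTrail.edges_nodup]
  exact hD.le_walk hc p

/-- The changes that UpdateTree makes to a spanning tree and the terminal costs. -/
structure Improves (T : Finset X) (x y : Finset (Sym2 X) × (Sym2 X → ℝ≥0∞)) : Prop where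
  tree : IsSpanningTree T y.1
  cost_le : ∀ e, y.2 e ≤ x.2 e
  connLE : ∀ w e, ConnLE x.1 x.2 w e → ConnLE y.1 y.2 w e
  -- Not an instance of `connLE`: the threshold, the cost of `e` itself, may drop too.
  settled : ∀ e, Settled x e → Settled y e
  dist_le : ∀ D, IsDist D → (∀ e, D e ≤ x.2 e) → ∀ e, D e ≤ y.2 e

variable {x y z : Finset (Sym2 X) × (Sym2 X → ℝ≥0∞)}

theorem Improves.refl (h : IsSpanningTree T x.1) : Improves T x x :=
  ⟨h, fun _ => le_rfl, fun _ _ => id, fun _ => id, fun _ _ => id⟩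

theorem Improves.trans (h : Improves T x y) (h' : Improves T y z) : Improves T x z where
  tree := h'.tree
  cost_le e := (h'.cost_le e).trans (h.cost_le e)
  connLE w e := h'.connLE w e ∘ h.connLE w e
  settled e := h'.settled e ∘ h.settled e
  dist_le D hD := h'.dist_le D hD ∘ h.dist_le D hD

theorem settled_of_mem (h : e ∈ x.1) : Settled x e := .of_mem h le_rfl

/-- A swap removes a most expensive edge of the cycle, so connections through it are rerouted along
edges that cost no more. Lowering `c e` to the sum over `P` keeps `e` settled, as the sum is at
least the maximum, and keeps it above any distance below `c`, by the triangle inequality. -/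
theorem improves_exchange (hT : T.Nonempty) (hx : IsSpanningTree T x.1) (he : e ∈ termPairs T)
    (hex : e ∉ x.1) (hP : IsCycleRest x.1 e P) (hf : IsArgmax x.2 P f) :
    Improves T x (exchange e P f x) ∧ Settled (exchange e P f x) e ∧
      (exchange e P f x).1 ⊆ insert e x.1 := by
  have hfx : f ∈ x.1 := hP.subset hf.1
  have hind := ((isSpanningTree_iff hT).1 hx).2.2
  unfold exchange
  split_ifs with h1 h2
  · refine ⟨?_, settled_of_mem (Finset.mem_insert_self _ _),
      Finset.insert_subset_insert _ (Finset.erase_subset _ _)⟩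
    have hconn : ∀ w e', ConnLE x.1 x.2 w e' → ConnLE (insert e (x.1.erase f)) x.2 w e' := by
      intro w e' h
      refine h.bind fun f' hf' hw => ?_
      by_cases hff : f' = f
      · subst hff
        induction e with | _ u v
        rintro a b rfl
        -- The detour around `f` is the rest of its cycle: the other edges of `P`, and `e`.
        refine ((hP.conn u v rfl).exchange hf.1 fun hc => hP.not_conn_erase hind hf.1 u v rfl
          (hc.mono (Finset.erase_subset_erase _ hP.subset))).mono fun e'' he'' => ?_
        simp only [Finset.mem_insert, Finset.mem_erase, Finset.mem_filter] at he'' ⊢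
        rcases he'' with rfl | he''
        · exact ⟨.inl rfl, h1.le.trans hw⟩
        · exact ⟨.inr ⟨he''.1, hP.subset he''.2⟩, (hf.2 _ he''.2).trans hw⟩
      · exact .of_mem (Finset.mem_insert_of_mem (Finset.mem_erase.2 ⟨hff, hf'⟩)) hw
    refine ⟨?_, fun _ => le_rfl, hconn, fun e' h => hconn _ _ h, fun _ _ => id⟩
    induction e with | _ u v
    exact hx.exchange hT he hfx (hP.not_conn_erase hind hf.1 u v rfl)
  · have hle : ∀ e', Function.update x.2 e (∑ e' ∈ P, x.2 e') e' ≤ x.2 e' := by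
      intro e'
      rw [Function.update_apply]
      split_ifs with h
      exacts [h ▸ h2.le, le_rfl]
    have hconn : ∀ w e', ConnLE x.1 x.2 w e' →
        ConnLE x.1 (Function.update x.2 e (∑ e' ∈ P, x.2 e')) w e' :=
      fun w e' h => h.mono subset_rfl (fun f _ => hle f) le_rfl
    have hset : Settled (x.1, Function.update x.2 e (∑ e' ∈ P, x.2 e')) e := by
      refine hconn _ _ ((hP.connLE hf).mono subset_rfl (fun _ _ => le_rfl) ?_)
      simp only [Function.update_self]
      exact Finset.single_le_sum (f := x.2) (fun _ _ => zero_le) hf.1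
    refine ⟨⟨hx, hle, hconn, fun e' h => ?_, fun D hD h e' => ?_⟩, hset,
      Finset.subset_insert _ _⟩
    · by_cases hee : e' = e
      · exact hee ▸ hset
      · refine hconn _ _ ?_
        simp only [Function.update_of_ne hee]
        exact h
    · by_cases hee : e' = e
      · subst hee
        simpa using hP.dist_le hD h
      · simpa [Function.update_of_ne hee] using h e'
  · exact ⟨.refl hx, (hP.connLE hf).mono subset_rfl (fun _ _ => le_rfl) (not_lt.1 h1),
      Finset.subset_insert _ _⟩

/-- A pair settled at its turn remains settled, so one pass suffices. The last clause serves to keep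
the tree inside the set of active edges. -/
theorem ExchangeLoop.improves (hT : T.Nonempty) {l : List (Sym2 X)} (h : ExchangeLoop l x y)
    (hl : ∀ e ∈ l, e ∈ termPairs T) (hx : IsSpanningTree T x.1) :
    Improves T x y ∧ (∀ e ∈ l, Settled y e) ∧ ∀ e ∈ y.1, e ∈ x.1 ∨ e ∈ l := by
  induction h with
  | nil x => exact ⟨.refl hx, by simp, fun e => .inl⟩
  | skip hmem _ ih =>
    rw [List.forall_mem_cons] at hl
    obtain ⟨h1, h2, h3⟩ := ih hl.2 hx
    refine ⟨h1, ?_, fun e he => (h3 e he).imp_right (List.mem_cons_of_mem _)⟩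
    rw [List.forall_mem_cons]
    exact ⟨h1.settled _ (settled_of_mem hmem), h2⟩
  | step hmem hP hf _ ih =>
    rw [List.forall_mem_cons] at hl
    obtain ⟨i1, i2, i3⟩ := improves_exchange hT hx hl.1 hmem hP hf
    obtain ⟨h1, h2, h3⟩ := ih hl.2 i1.tree
    refine ⟨i1.trans h1, ?_, fun e he => ?_⟩
    · rw [List.forall_mem_cons]
      exact ⟨h1.settled _ i2, h2⟩
    · rcases h3 e he with h | h
      · rcases Finset.mem_insert.1 (i3 h) with rfl | h
        · exact .inr List.mem_cons_self
        · exact .inl h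
      · exact .inr (List.mem_cons_of_mem _ h)

theorem ExchangeLoop.exists (hT : T.Nonempty) (l : List (Sym2 X))
    (hl : ∀ e ∈ l, e ∈ termPairs T) (x : Finset (Sym2 X) × (Sym2 X → ℝ≥0∞))
    (hx : IsSpanningTree T x.1) : ∃ y, ExchangeLoop l x y := by
  induction l generalizing x with
  | nil => exact ⟨x, .nil x⟩
  | cons e l ih =>
    rw [List.forall_mem_cons] at hl
    by_cases he : e ∈ x.1
    · obtain ⟨y, hy⟩ := ih hl.2 x hx
      exact ⟨y, .skip he hy⟩
    · obtain ⟨P, hP⟩ := hx.exists_isCycleRest hT hl.1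
      obtain ⟨f, hf⟩ := hP.exists_isArgmax hl.1 x.2
      obtain ⟨y, hy⟩ := ih hl.2 _ (improves_exchange hT hx hl.1 he hP hf).1.tree
      exact ⟨y, .step he hP hf hy⟩

/-- When `e` is scanned, every edge accepted so far costs at most `c e`; so `e` is settled whether
it is rejected, by the cycle it closes, or accepted. -/
theorem kruskal_foldl (l : List (Sym2 X)) (hl : l.Pairwise fun e f => c e ≤ c f) :
    Indep (l.foldl kruskalAdd ∅) ∧ (∀ e ∈ l.foldl kruskalAdd ∅, e ∈ l) ∧
      ∀ e ∈ l, ConnLE (l.foldl kruskalAdd ∅) c (c e) e := by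
  induction l using List.reverseRecOn with
  | nil => simp [Indep]
  | append_singleton l e ih =>
    rw [List.pairwise_append] at hl
    obtain ⟨h1, h2, h3⟩ := ih hl.1
    rw [List.foldl_append, List.foldl_cons, List.foldl_nil]
    generalize l.foldl kruskalAdd ∅ = F at h1 h2 h3
    have hFe : ∀ f ∈ F, c f ≤ c e := fun f hf => hl.2.2 f (h2 f hf) e (by simp)
    simp only [List.mem_append, List.mem_singleton, or_imp, forall_and, forall_eq]
    unfold kruskalAdd
    split_ifs with h
    · refine ⟨h1, fun f hf => .inl (h2 f hf), h3, ?_⟩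
      obtain ⟨u, v, rfl, huv⟩ := h
      rw [connLE_mk]
      exact Conn.mono (F := F) huv fun f hf => Finset.mem_filter.2 ⟨hf, hFe f hf⟩
    · refine ⟨?_, ?_, fun f hf => (h3 f hf).mono (Finset.subset_insert _ _)
        (fun _ _ => le_rfl) le_rfl, .of_mem (Finset.mem_insert_self _ _) le_rfl⟩
      · induction e with | _ u v
        exact h1.insert fun huv => h ⟨u, v, rfl, huv⟩
      · intro f hf
        exact (Finset.mem_insert.1 hf).symm.imp_left (h2 f)

/-- The alternative in `hconn` reflects the double role of `∅`, which signals failure but is also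
the spanning tree of a single terminal. -/
theorem IsKruskal.spec (hT : T.Nonempty) (h : IsKruskal T c S)
    (hconn : S ≠ ∅ ∨ ∀ u ∈ T, ∀ v ∈ T, Conn ((termPairs T).filter fun e => c e < ⊤) u v) :
    IsSpanningTree T S ∧ ∀ e ∈ termPairs T, Settled (S, c) e := by
  obtain ⟨l, -, hmem, hsort, hS⟩ := h
  obtain ⟨h1, h2, h3⟩ := kruskal_foldl l hsort
  have htree : IsSpanningTree T (l.foldl kruskalAdd ∅) := by
    rcases hconn with hne | hconn
    · by_contra hcon
      exact hne (by rw [hS, if_neg hcon])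
    · refine (isSpanningTree_iff hT).2 ⟨fun e he => ((hmem e).1 (h2 e he)).1, ?_, h1⟩
      intro u hu v hv
      refine (hconn u hu v hv).bind fun a b hab => ?_
      rw [Finset.mem_filter] at hab
      exact (h3 _ ((hmem _).2 hab) a b rfl).mono (Finset.filter_subset _ _)
  rw [if_pos htree] at hS
  rw [hS]
  refine ⟨htree, fun e he => ?_⟩
  by_cases hc : c e < ⊤
  · exact h3 e ((hmem e).2 ⟨he, hc⟩)
  -- A pair of infinite cost never enters the list, but any connection in the tree settles it.
  · induction e with | _ u v
    have huv := mem_termPairs.1 he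
    refine .of_subset (P := l.foldl kruskalAdd ∅) (fun x y hxy => ?_) subset_rfl
      fun f _ => le_top.trans (not_lt.1 hc)
    have hxy' := mem_termPairs.1 (hxy ▸ he)
    exact ((isSpanningTree_iff hT).1 htree).2.1 x hxy'.1 y hxy'.2.1

theorem IsKruskal.exists (T : Finset X) (c : Sym2 X → ℝ≥0∞) : ∃ S, IsKruskal T c S := by
  let L := ((termPairs T).filter fun e => c e < ⊤).toList
  have : Std.Total fun e f : Sym2 X => c e ≤ c f := ⟨fun e f => le_total _ _⟩
  have : IsTrans (Sym2 X) fun e f : Sym2 X => c e ≤ c f := ⟨fun _ _ _ => le_trans⟩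
  refine ⟨_, L.insertionSort fun e f => c e ≤ c f, ?_, ?_, ?_, rfl⟩
  · exact (List.perm_insertionSort _ L).nodup_iff.2 (Finset.nodup_toList _)
  · intro e
    rw [List.mem_insertionSort, Finset.mem_toList, Finset.mem_filter]
  · exact List.pairwise_insertionSort _ L

theorem ConnLE.not_mem_termPairs (h : ConnLE ∅ c w e) :
    e ∉ termPairs T := by
  intro he
  induction e with | _ u v
  exact (mem_termPairs.1 he).2.2 ((h u v rfl).mono (Finset.filter_subset _ _)).of_empty

/-- A tree whose bottlenecks with respect to the larger costs `c` are bounded by `D` is a minimum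
spanning tree for `D`, and the two costs agree on it. -/
theorem isMST_of_bottleneck {D : Sym2 X → ℝ≥0∞} (hT : T.Nonempty) (hS : IsSpanningTree T S)
    (hDc : ∀ e, D e ≤ c e)
    (hle : ∀ u v, s(u, v) ∈ termPairs T → ∀ f ∈ S, ¬ Conn (S.erase f) u v → c f ≤ D s(u, v)) :
    IsMST T D S ∧ ∀ e ∈ S, c e = D e := by
  have hSi := (isSpanningTree_iff hT).1 hS
  refine ⟨isMST_of_conn hT hS fun u v huv => ?_, fun e he => ?_⟩
  · obtain ⟨P, hP⟩ := hS.exists_isCycleRest hT huv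
    refine (hP.conn u v rfl).mono fun f hf => Finset.mem_filter.2 ⟨hP.subset hf, ?_⟩
    exact (hDc f).trans
      (hle u v huv f (hP.subset hf) (hP.not_conn_erase hSi.2.2 hf u v rfl))
  · induction e with | _ u v
    exact (hle u v (hSi.1 he) _ he (hSi.2.2 u v he)).antisymm (hDc _)

end Update

/-! ### Invariants of the tree and of the active edges. -/

section Tree

open Classical

variable {X : Type*} [TopologicalSpace X] (I : Problem X) {S A : Finset (Sym2 X)}
  {c D : Sym2 X → ℝ≥0∞}

/-- What holds for the tree, the active edges and the terminal costs throughout the algorithm. -/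
structure TreeInv (S A : Finset (Sym2 X)) (c : Sym2 X → ℝ≥0∞) : Prop where
  subset_active : S ⊆ A
  active_subset : A ⊆ termPairs I.T
  tree : S = ∅ ∨ IsSpanningTree I.T S
  pruned : ∀ e ∈ termPairs I.T, e ∉ A → ∃ w < (I.h e : ℝ≥0∞), ConnLE S c w e

variable {I}

theorem TreeInv.mono {c' : Sym2 X → ℝ≥0∞} (h : TreeInv I S A c) (hc : ∀ e, c' e ≤ c e) :
    TreeInv I S A c' :=
  ⟨h.subset_active, h.active_subset, h.tree, fun e he heA =>
    (h.pruned e he heA).imp fun _ hw =>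
      ⟨hw.1, hw.2.mono subset_rfl (fun f _ => hc f) le_rfl⟩⟩

/-- Without tree edges no pair closes a cycle, so nothing can have been pruned. Hence the tree found
by Kruskal, which ignores `A`, consists of active edges. -/
theorem TreeInv.active_eq (h : TreeInv I ∅ A c) : A = termPairs I.T := by
  refine h.active_subset.antisymm fun e he => ?_
  by_contra heA
  obtain ⟨w, -, hw⟩ := h.pruned e he heA
  exact hw.not_mem_termPairs he

/-- The effect of UpdateTree. -/
theorem TreeInv.updateTree {y : Finset (Sym2 X) × (Sym2 X → ℝ≥0∞)} (h : TreeInv I S A c)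
    (hy : UpdateTree I.T A (S, c) y) (hD : IsDist D) (hDc : ∀ e, D e ≤ c e)
    (hh : ∀ e ∈ termPairs I.T, (I.h e : ℝ≥0∞) ≤ D e) :
    TreeInv I y.1 A y.2 ∧ (∀ e, y.2 e ≤ c e) ∧ (∀ e, D e ≤ y.2 e) ∧
      ((∀ u ∈ I.T, ∀ v ∈ I.T, Conn ((termPairs I.T).filter fun e => c e < ⊤) u v) →
        IsSpanningTree I.T y.1 ∧ ∀ e ∈ termPairs I.T, Settled y e) := by
  have hT := I.T_nonempty
  obtain ⟨S', c'⟩ := y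
  rcases hy with ⟨hS, hK, hc'⟩ | ⟨hS, l, -, hlA, hAl, hloop⟩
  · simp only at hS hK hc'
    subst hS hc'
    have hA := h.active_eq
    subst hA
    refine ⟨⟨?_, subset_rfl, ?_, fun e he he' => absurd he he'⟩, fun _ => le_rfl, hDc,
      fun hconn => hK.spec hT (.inr hconn)⟩
    · by_cases hS' : S' = ∅
      · simp [hS']
      · exact (hK.spec hT (.inl hS')).1.1
    · by_cases hS' : S' = ∅
      · exact .inl hS'
      · exact .inr (hK.spec hT (.inl hS')).1
  · have htree := h.tree.resolve_left hS
    obtain ⟨hi, hset, hmem⟩ :=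
      hloop.improves hT (fun e he => h.active_subset (hlA e he)) htree
    have hpr : ∀ e ∈ termPairs I.T, e ∉ A → ∃ w < (I.h e : ℝ≥0∞), ConnLE S' c' w e :=
      fun e he heA => (h.pruned e he heA).imp fun w hw => ⟨hw.1, hi.connLE w e hw.2⟩
    refine ⟨⟨?_, h.active_subset, .inr hi.tree, hpr⟩, hi.cost_le, hi.dist_le D hD hDc,
      fun _ => ⟨hi.tree, fun e he => ?_⟩⟩
    · intro e he
      exact (hmem e he).elim (fun h' => h.subset_active h') (hlA e)
    · by_cases heA : e ∈ A
      · by_cases heS : e ∈ S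
        · exact hi.settled e (settled_of_mem heS)
        · exact hset e (hAl e heA heS)
      -- A pruned pair needs no scan: its bottleneck is below `h e`, and `h e ≤ D e` is at most its
      -- cost.
      · obtain ⟨w, hw, hconn⟩ := hpr e he heA
        exact hconn.mono subset_rfl (fun _ _ => le_rfl)
          ((hw.le.trans (hh e he)).trans (hi.dist_le D hD hDc e))

theorem TreeInv.exists_updateTree (h : TreeInv I S A c) : ∃ y, UpdateTree I.T A (S, c) y := by
  by_cases hS : S = ∅
  · obtain ⟨S', hS'⟩ := IsKruskal.exists I.T c
    exact ⟨(S', c), .inl ⟨hS, hS', rfl⟩⟩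
  · obtain ⟨y, hy⟩ := ExchangeLoop.exists I.T_nonempty A.toList
      (fun e he => h.active_subset (Finset.mem_toList.1 he)) (S, c) (h.tree.resolve_left hS)
    exact ⟨y, .inr ⟨hS, A.toList, A.nodup_toList, fun e => Finset.mem_toList.1,
      fun e he _ => Finset.mem_toList.2 he, hy⟩⟩

theorem TreeInv.prune (h : TreeInv I S A c) :
    TreeInv I S (A.filter fun e => ¬ I.Prunable S c e) c where
  subset_active e he := Finset.mem_filter.2 ⟨h.subset_active he, fun hp => hp.1 he⟩
  active_subset := (Finset.filter_subset _ _).trans h.active_subset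
  tree := h.tree
  pruned e he heA := by
    by_cases heA' : e ∈ A
    · have hp : I.Prunable S c e := by
        by_contra hp
        exact heA (Finset.mem_filter.2 ⟨heA', hp⟩)
      obtain ⟨-, P, f, hP, hf, hlt⟩ := hp
      exact ⟨_, hlt, hP.connLE hf⟩
    · exact h.pruned e he heA'

end Tree

namespace Problem

/-! ### The roadmap metric and the lower bound `h`. -/

section Metric

variable {X : Type*} [TopologicalSpace X] (I : Problem X) {V V' : Finset X}

theorem dist_comm (u v : X) : I.dist u v = I.dist v u := I.planner_comm u v

variable {I}

theorem mem_nbrs {u v : X} : v ∈ I.nbrs V u ↔ v ∈ V ∧ v ≠ u ∧ I.dist u v ≤ I.radius := by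
  simp [nbrs]

theorem roadmap_adj {u v : X} :
    (I.roadmap V).Adj u v ↔ u ∈ V ∧ v ∈ V ∧ v ≠ u ∧ I.dist u v ≤ I.radius := by
  simp [roadmap, mem_nbrs]

theorem walkCost_nil {u : X} : I.walkCost (.nil : (I.roadmap V).Walk u u) = 0 := by
  simp [walkCost]

theorem walkCost_cons {u v w : X} (h : (I.roadmap V).Adj u v) (p : (I.roadmap V).Walk v w) :
    I.walkCost (.cons h p) = I.dist u v + I.walkCost p := by
  simp [walkCost, edgeCost]

theorem walkCost_lt_top {u v : X} (p : (I.roadmap V).Walk u v) : I.walkCost p < ⊤ := by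
  induction p with
  | nil => simp [walkCost_nil]
  | cons h p ih =>
    rw [walkCost_cons]
    exact ENNReal.add_lt_top.2 ⟨(roadmap_adj.1 h).2.2.2.trans_lt ENNReal.coe_lt_top, ih⟩

theorem metricCompletion_mk (u v : X) :
    I.metricCompletion V s(u, v) = ⨅ p : (I.roadmap V).Walk u v, I.walkCost p := rfl

theorem metricCompletion_le_walkCost {u v : X} (p : (I.roadmap V).Walk u v) :
    I.metricCompletion V s(u, v) ≤ I.walkCost p := iInf_le _ p

theorem isDist_metricCompletion : IsDist (I.metricCompletion V) where
  self u := le_antisymm ((metricCompletion_le_walkCost .nil).trans_eq walkCost_nil) zero_le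
  triangle u v w := by
    simp only [metricCompletion_mk]
    refine ENNReal.le_iInf_add_iInf fun p q => (iInf_le _ (p.append q)).trans_eq ?_
    simp [walkCost, SimpleGraph.Walk.edges_append]

theorem metricCompletion_le_dist {u v : X} (h : (I.roadmap V).Adj u v) :
    I.metricCompletion V s(u, v) ≤ I.dist u v :=
  (metricCompletion_le_walkCost (.cons h .nil)).trans_eq (by simp [walkCost_cons, walkCost_nil])

theorem roadmap_mono (h : V ⊆ V') : I.roadmap V ≤ I.roadmap V' := by
  intro u v huv
  rw [roadmap_adj] at huv ⊢
  exact ⟨h huv.1, h huv.2.1, huv.2.2⟩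

theorem metricCompletion_anti (h : V ⊆ V') (e : Sym2 X) :
    I.metricCompletion V' e ≤ I.metricCompletion V e := by
  induction e with | _ u v
  refine le_iInf fun p => (iInf_le _ (p.mapLe (roadmap_mono h))).trans_eq ?_
  simp only [walkCost, SimpleGraph.Walk.edges_mapLe_eq_edges]

theorem exists_path_of_adj {u v : X} (h : (I.roadmap V).Adj u v) :
    ∃ σ : Path u v, (∀ t, σ t ∈ I.free) ∧ I.pathCost σ = I.dist u v := by
  have hd := (roadmap_adj.1 h).2.2.2.trans_lt ENNReal.coe_lt_top
  unfold dist at hd ⊢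
  cases hp : I.planner u v with
  | none => simp [hp] at hd
  | some σ => exact ⟨σ.1, σ.2, rfl⟩

/-- A nontrivial walk in the roadmap is followed by a feasible path of the same cost. -/
theorem exists_path_of_walk {u v w : X} (h : (I.roadmap V).Adj u v) (p : (I.roadmap V).Walk v w) :
    ∃ σ : Path u w, (∀ t, σ t ∈ I.free) ∧ I.pathCost σ = I.walkCost (.cons h p) := by
  induction p generalizing u with
  | nil =>
    obtain ⟨σ, hσ, hc⟩ := exists_path_of_adj h
    exact ⟨σ, hσ, by rw [hc, walkCost_cons, walkCost_nil, add_zero]⟩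
  | cons h' p ih =>
    obtain ⟨σ, hσ, hc⟩ := exists_path_of_adj h
    obtain ⟨τ, hτ, hc'⟩ := ih h'
    refine ⟨σ.trans τ, fun t => ?_, by rw [I.pathCost_trans, hc, hc', walkCost_cons h]⟩
    rw [Path.trans_apply]
    split_ifs
    exacts [hσ _, hτ _]

/-- The diagonal is excluded because the empty walk costs 0, while constant paths are not assumed to
have cost 0. -/
theorem h_le_metricCompletion {e : Sym2 X} (he : ¬ e.IsDiag) :
    (I.h e : ℝ≥0∞) ≤ I.metricCompletion V e := by
  induction e with | _ u v
  refine le_iInf fun p => ?_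
  cases p with
  | nil => simp at he
  | cons h p =>
    obtain ⟨σ, hσ, hc⟩ := exists_path_of_walk h p
    exact hc ▸ I.h_le u v σ hσ

end Metric

end Problem

/-! ### Ripple: soundness, relaxation and termination. -/

/-- Scanning changes neither the nodes nor the pending samples, and it lowers `g` if it changes `g`
or the queue. -/
structure Progress {X : Type*} (st st' : State X) : Prop where
  V_eq : st'.V = st.V
  pending_eq : st'.pending = st.pending
  lt_or_eq : st'.g < st.g ∨ (st'.g = st.g ∧ st'.Q = st.Q)

theorem Progress.trans {X : Type*} {st st' st'' : State X} (h : Progress st st') (h' : Progress st' st'') :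
    Progress st st'' := by
  refine ⟨h'.V_eq.trans h.V_eq, h'.pending_eq.trans h.pending_eq, ?_⟩
  rcases h.lt_or_eq with h1 | ⟨h1, h2⟩
  · rcases h'.lt_or_eq with h3 | ⟨h3, -⟩
    · exact .inl (h3.trans h1)
    · exact .inl (h3 ▸ h1)
  · rw [← h1, ← h2]
    exact h'.lt_or_eq

namespace Problem

section Ripple

open Classical

variable {X : Type*} [TopologicalSpace X] (I : Problem X)

/-- The possible values of `g` for a roadmap with nodes in `W`. -/
def values (W : Finset X) : Set ℝ≥0∞ :=
  -- An infinite `dist` contributes 0 through `toNNReal`, which is in the submonoid anyway.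
  insert ⊤ ((fun x : ℝ≥0 => (x : ℝ≥0∞)) '' (AddSubmonoid.closure
    (((W ×ˢ W).image fun p => (I.dist p.1 p.2).toNNReal : Finset ℝ≥0) : Set ℝ≥0) : Set ℝ≥0))

theorem values_isWF (W : Finset X) : (I.values W).IsWF := by
  rw [← Set.isPWO_iff_isWF]
  refine Set.IsPWO.insert (Set.IsPWO.image_of_monotone ?_ fun _ _ h => ENNReal.coe_le_coe.2 h) _
  exact Set.IsPWO.addSubmonoid_closure (fun _ _ => zero_le) (Finset.isPWO _)

variable {I}

theorem values_mono {W W' : Finset X} (h : W ⊆ W') : I.values W ⊆ I.values W' := by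
  refine Set.insert_subset_insert (Set.image_mono ?_)
  exact AddSubmonoid.closure_mono (by
    exact_mod_cast Finset.image_subset_image (Finset.product_subset_product h h))

theorem top_mem_values (W : Finset X) : ⊤ ∈ I.values W := Set.mem_insert _ _

theorem zero_mem_values (W : Finset X) : 0 ∈ I.values W :=
  .inr ⟨0, AddSubmonoid.zero_mem _, rfl⟩

theorem add_mem_values {W : Finset X} {x : ℝ≥0∞} {u v : X} (hx : x ∈ I.values W) (hu : u ∈ W)
    (hv : v ∈ W) : x + I.dist u v ∈ I.values W := by
  by_cases hd : I.dist u v = ⊤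
  · rw [hd, add_top]
    exact top_mem_values W
  rcases hx with rfl | ⟨y, hy, rfl⟩
  · rw [top_add]
    exact top_mem_values W
  · refine .inr ⟨y + (I.dist u v).toNNReal, AddSubmonoid.add_mem _ hy ?_, ?_⟩
    · exact AddSubmonoid.subset_closure
        (Finset.mem_coe.2 (Finset.mem_image.2 ⟨(u, v), Finset.mk_mem_product hu hv, rfl⟩))
    · simp [ENNReal.coe_toNNReal hd]

variable (I) in
/-- The values of the variables are correct, though perhaps not optimal. -/
structure Sound (st : State X) : Prop where
  terminals_subset : I.T ⊆ st.V
  disjoint : Disjoint st.pending st.V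
  outside : ∀ v ∉ st.V, st.g v = ⊤
  root_none : ∀ v, st.root v = none → st.g v = ⊤
  root_some : ∀ v r, st.root v = some r →
    r ∈ I.T ∧ st.g v < ⊤ ∧ I.metricCompletion st.V s(r, v) ≤ st.g v
  terminal : ∀ t ∈ I.T, st.g t = 0 ∧ st.root t = some t
  value : ∀ v, st.g v ∈ I.values (st.V ∪ st.pending)
  cost : ∀ e, I.metricCompletion st.V e ≤ st.costT e
  tree : TreeInv I st.S st.A st.costT
  queue : ∀ q ∈ st.Q, q.1 ∈ st.V

theorem Sound.exists_root {st : State X} (h : I.Sound st) {v : X} (hv : st.g v < ⊤) :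
    ∃ r, st.root v = some r := by
  cases hr : st.root v with
  | none => exact absurd (h.root_none v hr) hv.ne
  | some r => exact ⟨r, rfl⟩

variable (I) in
/-- The edges of the roadmap are relaxed, except for those that still have to be scanned. -/
structure Relaxed (dirty : X → X → Prop) (st : State X) : Prop where
  le : ∀ u v, (I.roadmap st.V).Adj u v → dirty u v ∨ st.g v ≤ st.g u + I.dist u v
  cost : ∀ u v a b, (I.roadmap st.V).Adj u v → st.root u = some a → st.root v = some b → a ≠ b →
    dirty u v ∨ dirty v u ∨ st.costT s(a, b) ≤ st.g u + I.dist u v + st.g v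

/-- The node `u` is in the queue. -/
def Queued (st : State X) (u : X) : Prop := ∃ k, (u, k) ∈ st.Q

theorem Relaxed.mono {d d' : X → X → Prop} {st : State X} (h : I.Relaxed d st)
    (hd : ∀ u v, d u v → d' u v) : I.Relaxed d' st :=
  ⟨fun u v huv => (h.le u v huv).imp_left (hd u v), fun u v a b huv ha hb hab =>
    (h.cost u v a b huv ha hb hab).imp (hd u v) (Or.imp_left (hd v u))⟩

/-- The outcomes of the scan of a neighbour: an improvement of `g n`, or an update of `costT`. -/
theorem scan_cases (u n : X) (st : State X) :
    (st.g u + I.dist u n < st.g n ∧ I.scan u st n =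
      { st with
        g := Function.update st.g n (st.g u + I.dist u n)
        Q := (n, st.g u + I.dist u n) ::ₘ st.Q
        root := Function.update st.root n (st.root u)
        parent := Function.update st.parent n (some u) }) ∨
    (st.g n ≤ st.g u + I.dist u n ∧ ∃ c, I.scan u st n = { st with costT := c } ∧
      (∀ e, c e ≤ st.costT e) ∧
      (∀ e, c e = st.costT e ∨ ∃ a b, st.root n = some a ∧ st.root u = some b ∧ e = s(a, b) ∧
        c e = st.g n + I.dist n u + st.g u) ∧
      ∀ a b, st.root n = some a → st.root u = some b → a ≠ b →
        c s(a, b) ≤ st.g n + I.dist n u + st.g u) := by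
  unfold scan
  split_ifs with h
  · exact .inl ⟨h, rfl⟩
  refine .inr ⟨not_lt.1 h, ?_⟩
  split
  · rename_i a b ha hb
    split_ifs with hab
    · refine ⟨_, rfl, fun e => ?_, fun e => ?_, fun a' b' ha' hb' _ => ?_⟩
      · rw [Function.update_apply]
        split_ifs with he
        exacts [he ▸ hab.2.le, le_rfl]
      · rw [Function.update_apply]
        split_ifs with he
        exacts [.inr ⟨a, b, ha, hb, he, rfl⟩, .inl rfl]
      · rw [ha, Option.some_inj] at ha'
        rw [hb, Option.some_inj] at hb'
        subst ha' hb'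
        simp
    · refine ⟨st.costT, rfl, fun _ => le_rfl, fun _ => .inl rfl, fun a' b' ha' hb' hne => ?_⟩
      rw [ha, Option.some_inj] at ha'
      rw [hb, Option.some_inj] at hb'
      subst ha' hb'
      exact not_lt.1 fun hlt => hab ⟨hne, hlt⟩
  · rename_i hno
    exact ⟨st.costT, rfl, fun _ => le_rfl, fun _ => .inl rfl,
      fun a b ha hb _ => (hno a b ha hb).elim⟩

/-- Both kinds of update record an upper bound on a distance: from the root of `u` through the edge
to `n`, or between two roots across that edge. The triangle inequality does the rest. A terminal is
never relaxed, its `g` being 0. -/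
theorem Sound.scan {st : State X} (h : I.Sound st) {u n : X}
    (hun : (I.roadmap st.V).Adj u n) : I.Sound (I.scan u st n) := by
  have hD := isDist_metricCompletion (I := I) (V := st.V)
  have hadj := roadmap_adj.1 hun
  rcases scan_cases (I := I) u n st with ⟨hlt, heq⟩ | ⟨-, c, heq, hc, hc', -⟩
  · have hnT : n ∉ I.T := fun hn => by simp [(h.terminal n hn).1] at hlt
    obtain ⟨r, hr⟩ := h.exists_root ((le_self_add.trans_lt hlt).trans_le le_top)
    obtain ⟨hrT, hgu, hDu⟩ := h.root_some u r hr
    rw [heq]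
    refine ⟨h.terminals_subset, h.disjoint, fun v hv => ?_, fun v hv => ?_, fun v s hv => ?_,
      fun t ht => ?_, fun v => ?_, h.cost, h.tree,
      Multiset.forall_mem_cons.2 ⟨hadj.2.1, h.queue⟩⟩
    · have hvn : v ≠ n := fun h' => hv (h' ▸ hadj.2.1)
      simpa [Function.update_of_ne hvn] using h.outside v hv
    · by_cases hvn : v = n
      · simp [hvn, hr] at hv
      · simp only [Function.update_of_ne hvn] at hv ⊢
        exact h.root_none v hv
    · by_cases hvn : v = n
      · subst hvn
        simp only [Function.update_self, hr, Option.some_inj] at hv ⊢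
        subst hv
        exact ⟨hrT, hlt.trans_le le_top, (hD.triangle r u v).trans
          (add_le_add hDu (metricCompletion_le_dist hun))⟩
      · simp only [Function.update_of_ne hvn] at hv ⊢
        exact h.root_some v s hv
    · have htn : t ≠ n := fun h' => hnT (h' ▸ ht)
      simpa [Function.update_of_ne htn] using h.terminal t ht
    · by_cases hvn : v = n
      · subst hvn
        simp only [Function.update_self]
        exact add_mem_values (h.value u) (Finset.mem_union_left _ hadj.1)
          (Finset.mem_union_left _ hadj.2.1)
      · simp only [Function.update_of_ne hvn]
        exact h.value v
  · rw [heq]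
    refine ⟨h.terminals_subset, h.disjoint, h.outside, h.root_none, h.root_some, h.terminal,
      h.value, fun e => ?_, h.tree.mono hc, h.queue⟩
    rcases hc' e with he | ⟨a, b, ha, hb, rfl, he⟩
    · exact (h.cost e).trans_eq he.symm
    · simp only [he]
      refine (hD.triangle a u b).trans (add_le_add ((hD.triangle a n u).trans
        (add_le_add (h.root_some n a ha).2.2 (metricCompletion_le_dist hun.symm))) ?_)
      rw [Sym2.eq_swap]
      exact (h.root_some u b hb).2.2

/-- The edges that have to be scanned while `u` still has to scan the nodes in `l`. -/
def Dirty (u : X) (l : List X) (st : State X) (x y : X) : Prop :=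
  Queued st x ∨ (x = u ∧ y ∈ l)

/-- If `g n` drops, edges leaving `n` become dirty because `n` is queued, and inequalities into `n`
only become easier. Otherwise the scan has just checked both conditions on the edge `un`, which
leaves the dirty set. -/
theorem Relaxed.scan {st : State X} {u n : X} {l : List X}
    (h : I.Relaxed (Dirty u (n :: l) st) st) (hun : (I.roadmap st.V).Adj u n) :
    I.Relaxed (Dirty u l (I.scan u st n)) (I.scan u st n) := by
  rcases scan_cases (I := I) u n st with ⟨hlt, heq⟩ | ⟨hle, c, heq, hc, -, hc'⟩
  · have hQ : ∀ x, Queued st x → Queued (I.scan u st n) x := fun x ⟨k, hk⟩ =>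
      ⟨k, by rw [heq]; exact Multiset.mem_cons_of_mem hk⟩
    have hn : Queued (I.scan u st n) n :=
      ⟨_, by rw [heq]; exact Multiset.mem_cons_self _ _⟩
    have hg : ∀ x, x ≠ n → (I.scan u st n).g x = st.g x := fun x hx => by
      simp [heq, Function.update_of_ne hx]
    have hgn : (I.scan u st n).g n = st.g u + I.dist u n := by simp [heq]
    have hroot : ∀ x, x ≠ n → (I.scan u st n).root x = st.root x := fun x hx => by
      simp [heq, Function.update_of_ne hx]
    have hV : (I.scan u st n).V = st.V := by rw [heq]
    have hcost : (I.scan u st n).costT = st.costT := by rw [heq]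
    have hdirty : ∀ x y, y ≠ n → Dirty u (n :: l) st x y → Dirty u l (I.scan u st n) x y := by
      rintro x y hy (hx | ⟨hx, hyl⟩)
      · exact .inl (hQ x hx)
      · exact .inr ⟨hx, (List.mem_cons.1 hyl).resolve_left hy⟩
    constructor
    · intro x y hxy
      rw [hV] at hxy
      by_cases hx : x = n
      · exact .inl (.inl (hx ▸ hn))
      by_cases hy : y = n
      · subst hy
        rcases h.le x y hxy with (hq | ⟨rfl, -⟩) | hle
        · exact .inl (.inl (hQ x hq))
        · exact .inr (by rw [hgn, hg x hx])
        · exact .inr (by rw [hgn, hg x hx]; exact hlt.le.trans hle)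
      · rw [hg x hx, hg y hy]
        exact (h.le x y hxy).imp_left (hdirty x y hy)
    · intro x y a b hxy ha hb hab
      rw [hV] at hxy
      by_cases hx : x = n
      · exact .inl (.inl (hx ▸ hn))
      by_cases hy : y = n
      · exact .inr (.inl (.inl (hy ▸ hn)))
      rw [hroot x hx] at ha
      rw [hroot y hy] at hb
      rw [hg x hx, hg y hy, hcost]
      exact (h.cost x y a b hxy ha hb hab).imp (hdirty x y hy) (Or.imp_left (hdirty y x hx))
  · have hdirty : ∀ x y, (x = u ∧ y = n) ∨ Dirty u l (I.scan u st n) x y ∨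
        ¬ Dirty u (n :: l) st x y := by
      intro x y
      by_cases hd : Dirty u (n :: l) st x y
      · rcases hd with ⟨k, hk⟩ | ⟨rfl, hy⟩
        · exact .inr (.inl (.inl ⟨k, by rw [heq]; exact hk⟩))
        · rcases List.mem_cons.1 hy with rfl | hy
          · exact .inl ⟨rfl, rfl⟩
          · exact .inr (.inl (.inr ⟨rfl, hy⟩))
      · exact .inr (.inr hd)
    have hV : (I.scan u st n).V = st.V := by rw [heq]
    have hg : (I.scan u st n).g = st.g := by rw [heq]
    have hroot : (I.scan u st n).root = st.root := by rw [heq]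
    have hcost : (I.scan u st n).costT = c := by rw [heq]
    constructor
    · intro x y hxy
      rw [hV] at hxy
      rw [hg]
      rcases hdirty x y with ⟨rfl, rfl⟩ | hd | hd
      · exact .inr hle
      · exact .inl hd
      · exact .inr ((h.le x y hxy).resolve_left hd)
    · intro x y a b hxy ha hb hab
      rw [hV] at hxy
      rw [hroot] at ha hb
      rw [hg, hcost]
      have hsymm : st.g x + I.dist x y + st.g y = st.g y + I.dist y x + st.g x := by
        rw [I.dist_comm y x]
        ring
      rcases hdirty x y with ⟨rfl, rfl⟩ | hd | hd
      · rw [hsymm, Sym2.eq_swap]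
        exact .inr (.inr (hc' b a hb ha hab.symm))
      · exact .inl hd
      rcases hdirty y x with ⟨rfl, rfl⟩ | hd' | hd'
      · exact .inr (.inr (hc' a b ha hb hab))
      · exact .inr (.inl hd')
      · exact .inr (.inr ((hc _).trans
          (((h.cost x y a b hxy ha hb hab).resolve_left hd).resolve_left hd')))

theorem progress_scan (u n : X) (st : State X) : Progress st (I.scan u st n) := by
  rcases scan_cases (I := I) u n st with ⟨hlt, heq⟩ | ⟨hle, c, heq, -⟩
  · rw [heq]
    exact ⟨rfl, rfl, .inl (update_lt_self_iff.2 hlt)⟩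
  · rw [heq]
    exact ⟨rfl, rfl, .inr ⟨rfl, rfl⟩⟩

theorem foldl_scan (u : X) (l : List X) (st : State X) (hs : I.Sound st)
    (hr : I.Relaxed (Dirty u l st) st) (hl : ∀ n ∈ l, (I.roadmap st.V).Adj u n) :
    I.Sound (l.foldl (I.scan u) st) ∧
      I.Relaxed (fun x _ => Queued (l.foldl (I.scan u) st) x) (l.foldl (I.scan u) st) ∧
      Progress st (l.foldl (I.scan u) st) := by
  induction l generalizing st with
  | nil =>
    refine ⟨hs, hr.mono fun x y hxy => ?_, rfl, rfl, .inr ⟨rfl, rfl⟩⟩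
    exact hxy.elim id fun h' => absurd h'.2 List.not_mem_nil
  | cons n l ih =>
    rw [List.forall_mem_cons] at hl
    have hp := progress_scan (I := I) u n st
    obtain ⟨h1, h2, h3⟩ := ih _ (hs.scan hl.1) (hr.scan hl.1) (by rw [hp.V_eq]; exact hl.2)
    exact ⟨h1, h2, hp.trans h3⟩

variable (I) in
/-- The invariant of Ripple. -/
structure RippleInv (st : State X) : Prop where
  sound : I.Sound st
  relaxed : I.Relaxed (fun u _ => Queued st u) st

/-- A step of Ripple decreases, lexicographically, the number of pending samples, the function `g`
and the size of the queue. -/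
def Decreases (st st' : State X) : Prop :=
  st'.pending.card < st.pending.card ∨
    (st'.pending = st.pending ∧
      (st'.g < st.g ∨ (st'.g = st.g ∧ Multiset.card st'.Q < Multiset.card st.Q)))

theorem RippleInv.expand {st st' : State X} (h : I.RippleInv st) (hst : I.Expand st st') :
    I.RippleInv st' ∧ st'.V ∪ st'.pending = st.V ∪ st.pending ∧ Decreases st st' := by
  obtain ⟨u, k, l, hu, -, -, hl, rfl⟩ := hst
  have hs : I.Sound { st with Q := st.Q.erase (u, k) } :=
    { h.sound with queue := fun q hq => h.sound.queue q (Multiset.mem_of_mem_erase hq) }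
  have hdirty : ∀ x y, (I.roadmap st.V).Adj x y → Queued st x →
      Dirty u l { st with Q := st.Q.erase (u, k) } x y := by
    rintro x y hxy ⟨k', hk'⟩
    by_cases hx : x = u
    · exact .inr ⟨hx, (hl y).2 (hx ▸ hxy.2)⟩
    · exact .inl ⟨k', (Multiset.mem_erase_of_ne (by simp [hx])).2 hk'⟩
  have hr : I.Relaxed (Dirty u l { st with Q := st.Q.erase (u, k) })
      { st with Q := st.Q.erase (u, k) } :=
    ⟨fun x y hxy => (h.relaxed.le x y hxy).imp_left (hdirty x y hxy),
      fun x y a b hxy ha hb hab => (h.relaxed.cost x y a b hxy ha hb hab).imp (hdirty x y hxy)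
        (Or.imp_left (hdirty y x hxy.symm))⟩
  obtain ⟨h1, h2, h3⟩ := foldl_scan u l _ hs hr
    fun n hn => ⟨h.sound.queue _ hu, (hl n).1 hn⟩
  refine ⟨⟨h1, h2⟩, by rw [h3.V_eq, h3.pending_eq], .inr ⟨h3.pending_eq, ?_⟩⟩
  -- If no scan lowered `g`, nothing was pushed, and the queue has lost the extracted entry.
  refine h3.lt_or_eq.imp_right fun hgQ => ⟨hgQ.1, ?_⟩
  rw [hgQ.2]
  exact Multiset.card_erase_lt_of_mem hu

theorem roadmap_insert_adj {V : Finset X} {s u v : X} (h : (I.roadmap (insert s V)).Adj u v) :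
    (I.roadmap V).Adj u v ∨ u = s ∨ v = s := by
  rw [roadmap_adj] at h ⊢
  grind

theorem Sound.addNode {st : State X} (h : I.Sound st) {s : X} (hs : s ∈ st.pending) :
    I.Sound (addNode s st) ∧
      (Problem.addNode s st).V ∪ (Problem.addNode s st).pending = st.V ∪ st.pending := by
  have hsV : s ∉ st.V := Finset.disjoint_left.1 h.disjoint hs
  have hunion : insert s st.V ∪ st.pending.erase s = st.V ∪ st.pending := by
    rw [Finset.insert_union, ← Finset.union_insert, Finset.insert_erase hs]
  have hroot : ∀ v, v ≠ s → (Problem.addNode s st).root v = st.root v := fun v hv => by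
    simp [Problem.addNode, Function.update_of_ne hv]
  have hrs : (Problem.addNode s st).root s = none := by simp [Problem.addNode]
  have hsub : st.V ⊆ insert s st.V := Finset.subset_insert _ _
  refine ⟨⟨h.terminals_subset.trans hsub, ?_, fun v hv => h.outside v fun hv' => hv (hsub hv'),
    fun v hv => ?_, fun v r hv => ?_, fun t ht => ?_, fun v => ?_,
    fun e => (metricCompletion_anti hsub e).trans (h.cost e), h.tree,
    fun q hq => hsub (h.queue q hq)⟩, hunion⟩
  · refine Finset.disjoint_insert_right.2 ⟨Finset.notMem_erase s _, ?_⟩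
    exact h.disjoint.mono_left (Finset.erase_subset _ _)
  · by_cases hvs : v = s
    · exact h.outside v (hvs ▸ hsV)
    · exact h.root_none v (hroot v hvs ▸ hv)
  · by_cases hvs : v = s
    · rw [hvs, hrs] at hv
      exact absurd hv (by simp)
    · obtain ⟨h1, h2, h3⟩ := h.root_some v r (hroot v hvs ▸ hv)
      exact ⟨h1, h2, (metricCompletion_anti hsub _).trans h3⟩
  · have hts : t ≠ s := fun h' => hsV (h' ▸ h.terminals_subset ht)
    exact ⟨(h.terminal t ht).1, (hroot t hts).trans (h.terminal t ht).2⟩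
  · exact hunion.symm ▸ h.value v

/-- Only edges at the new node `s` need attention. If `s` stays unrooted, all its neighbours have `g
= ⊤`; if it is attached, `s` is queued, which covers all of them except the inequalities bounding `g
s`. -/
theorem RippleInv.pop {st st' : State X} (h : I.RippleInv st) (hst : I.Pop st st') :
    I.RippleInv st' ∧ st'.V ∪ st'.pending = st.V ∪ st.pending ∧ Decreases st st' := by
  obtain ⟨hQ, s, hs, hst⟩ := hst
  have hsV : s ∉ st.V := Finset.disjoint_left.1 h.sound.disjoint hs
  have hgs : st.g s = ⊤ := h.sound.outside s hsV
  have hsT : s ∉ I.T := fun h' => hsV (h.sound.terminals_subset h')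
  obtain ⟨hadd, hunion⟩ := h.sound.addNode hs
  have hcard : (st.pending.erase s).card < st.pending.card := Finset.card_erase_lt_of_mem hs
  have hroot : ∀ v, v ≠ s → (addNode s st).root v = st.root v := fun v hv => by
    simp [addNode, Function.update_of_ne hv]
  have hrs : (addNode s st).root s = none := by simp [addNode]
  have hnq : ∀ u, ¬ Queued st u := fun u ⟨k, hk⟩ => by simp [hQ] at hk
  have hle : ∀ u v, (I.roadmap st.V).Adj u v → st.g v ≤ st.g u + I.dist u v := fun u v huv =>
    (h.relaxed.le u v huv).resolve_left (hnq u)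
  have hcost : ∀ u v a b, (I.roadmap st.V).Adj u v → st.root u = some a → st.root v = some b →
      a ≠ b → st.costT s(a, b) ≤ st.g u + I.dist u v + st.g v := fun u v a b huv ha hb hab =>
    ((h.relaxed.cost u v a b huv ha hb hab).resolve_left (hnq u)).resolve_left (hnq v)
  rcases hst with ⟨hnone, rfl⟩ | ⟨n, hn, hnr, hmin, rfl⟩
  · refine ⟨⟨hadd, ?_, ?_⟩, hunion, .inl hcard⟩
    · intro u v huv
      right
      change st.g v ≤ st.g u + I.dist u v
      rcases roadmap_insert_adj huv with huv' | rfl | rfl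
      · exact hle u v huv'
      · have : st.g v = ⊤ := hadd.root_none v (hnone v huv.2)
        rw [hgs, top_add]
        exact le_top
      · have : st.g u = ⊤ := hadd.root_none u (hnone u huv.symm.2)
        rw [this, top_add]
        exact le_top
    · intro u v a b huv ha hb hab
      rcases roadmap_insert_adj huv with huv' | rfl | rfl
      · rw [hroot u fun h' => hsV (h' ▸ huv'.1)] at ha
        rw [hroot v fun h' => hsV (h' ▸ huv'.symm.1)] at hb
        exact .inr (.inr (hcost u v a b huv' ha hb hab))
      · simp [hrs] at ha
      · simp [hrs] at hb
  · have hsn : (I.roadmap (insert s st.V)).Adj s n := ⟨Finset.mem_insert_self _ _, hn⟩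
    obtain ⟨r, hr⟩ := Option.ne_none_iff_exists'.1 hnr
    obtain ⟨hrT, hgn, hDn⟩ := hadd.root_some n r hr
    have hD := isDist_metricCompletion (I := I) (V := insert s st.V)
    have hg' : ∀ v, v ≠ s → (I.attach s n (addNode s st)).g v = st.g v := fun v hv => by
      simp [attach, addNode, Function.update_of_ne hv]
    have hg's : (I.attach s n (addNode s st)).g s = st.g n + I.dist s n := by
      simp [attach, addNode]
    have hroot' : ∀ v, v ≠ s → (I.attach s n (addNode s st)).root v = (addNode s st).root v :=
      fun v hv => by simp [attach, Function.update_of_ne hv]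
    have hroot's : (I.attach s n (addNode s st)).root s = some r := by simp [attach, hr]
    have hsq : Queued (I.attach s n (addNode s st)) s := ⟨_, Multiset.mem_cons_self _ _⟩
    refine ⟨⟨⟨hadd.terminals_subset, hadd.disjoint, fun v hv => ?_, fun v hv => ?_,
      fun v r' hv => ?_, fun t ht => ?_, fun v => ?_, hadd.cost, hadd.tree, ?_⟩, ?_, ?_⟩,
      hunion, .inl hcard⟩
    · have hvs : v ≠ s := fun h' => hv (h' ▸ Finset.mem_insert_self _ _)
      rw [hg' v hvs]
      exact hadd.outside v hv
    · by_cases hvs : v = s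
      · simp [hvs, hroot's] at hv
      · rw [hg' v hvs]
        exact hadd.root_none v (hroot' v hvs ▸ hv)
    · by_cases hvs : v = s
      · subst hvs
        rw [hroot's, Option.some_inj] at hv
        subst hv
        rw [hg's]
        refine ⟨hrT, ENNReal.add_lt_top.2
          ⟨hgn, (roadmap_adj.1 hsn).2.2.2.trans_lt ENNReal.coe_lt_top⟩, ?_⟩
        refine (hD.triangle r n v).trans (add_le_add hDn ?_)
        rw [Sym2.eq_swap]
        exact metricCompletion_le_dist hsn
      · rw [hg' v hvs]
        exact hadd.root_some v r' (hroot' v hvs ▸ hv)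
    · have hts : t ≠ s := fun h' => hsT (h' ▸ ht)
      rw [hg' t hts, hroot' t hts]
      exact hadd.terminal t ht
    · by_cases hvs : v = s
      · subst hvs
        rw [hg's]
        exact add_mem_values (hadd.value n) (Finset.mem_union_left _ hsn.1)
          (Finset.mem_union_left _ hsn.symm.1)
      · rw [hg' v hvs]
        exact hadd.value v
    · exact Multiset.forall_mem_cons.2 ⟨hsn.1, hadd.queue⟩
    · intro u v huv
      rcases roadmap_insert_adj huv with huv' | rfl | rfl
      · rw [hg' u fun h' => hsV (h' ▸ huv'.1), hg' v fun h' => hsV (h' ▸ huv'.symm.1)]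
        exact .inr (hle u v huv')
      · exact .inl hsq
      · rw [hg' u huv.ne, hg's, I.dist_comm u v]
        by_cases hu : (addNode v st).root u = none
        · have : st.g u = ⊤ := hadd.root_none u hu
          rw [this, top_add]
          exact .inr le_top
        -- The choice of the best rooted neighbour gives the inequality into the new node.
        · exact .inr (hmin u huv.symm.2 hu)
    · intro u v a b huv ha hb hab
      rcases roadmap_insert_adj huv with huv' | rfl | rfl
      · have hu : u ≠ s := fun h' => hsV (h' ▸ huv'.1)
        have hv : v ≠ s := fun h' => hsV (h' ▸ huv'.symm.1)
        rw [hroot' u hu, hroot u hu] at ha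
        rw [hroot' v hv, hroot v hv] at hb
        rw [hg' u hu, hg' v hv]
        exact .inr (.inr (hcost u v a b huv' ha hb hab))
      · exact .inl hsq
      · exact .inr (.inl hsq)

theorem RippleInv.step {st st' : State X} (h : I.RippleInv st) (hst : I.RippleStep st st') :
    I.RippleInv st' ∧ st'.V ∪ st'.pending = st.V ∪ st.pending ∧ Decreases st st' :=
  hst.elim h.expand h.pop

theorem RippleInv.reflTransGen {st st' : State X} (h : I.RippleInv st)
    (hst : Relation.ReflTransGen I.RippleStep st st') :
    I.RippleInv st' ∧ st'.V ∪ st'.pending = st.V ∪ st.pending := by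
  induction hst with
  | refl => exact ⟨h, rfl⟩
  | tail _ hstep ih =>
    obtain ⟨h1, h2, -⟩ := ih.1.step hstep
    exact ⟨h1, h2.trans ih.2⟩

/-- Ripple terminates. -/
theorem RippleInv.acc {st : State X} (h : I.RippleInv st) :
    Acc (fun b a => I.RippleStep a b) st := by
  -- `W`, the nodes together with the pending samples, is constant during Ripple, so one
  -- well-founded order serves all steps.
  have key : ∀ W : Finset X, ∀ m : ℕ × (W → I.values W) × ℕ, ∀ st : State X, I.RippleInv st →
      st.V ∪ st.pending = W → st.pending.card = m.1 → (∀ v : W, st.g v = m.2.1 v) →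
      Multiset.card st.Q = m.2.2 → Acc (fun b a => I.RippleStep a b) st := by
    intro W m
    have : WellFoundedLT (I.values W) := ⟨I.values_isWF W⟩
    have hwf : WellFounded (Prod.Lex (· < ·) (Prod.Lex (· < ·) (· < ·)) :
        ℕ × (W → I.values W) × ℕ → ℕ × (W → I.values W) × ℕ → Prop) :=
      (wellFounded_lt (α := ℕ)).prod_lex
        ((wellFounded_lt (α := W → I.values W)).prod_lex (wellFounded_lt (α := ℕ)))
    induction m using hwf.induction with
    | _ m ih =>
      intro st h hW h1 h2 h3
      refine ⟨_, fun st' hst => ?_⟩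
      obtain ⟨h', hW', hdec⟩ := h.step hst
      rw [hW] at hW'
      have hval : ∀ v, st'.g v ∈ I.values W := hW' ▸ h'.sound.value
      refine ih (st'.pending.card, fun v => ⟨st'.g v, hval v⟩,
        Multiset.card st'.Q) ?_ st' h' hW' rfl (fun _ => rfl) rfl
      obtain ⟨m1, m2, m3⟩ := m
      simp only at h1 h2 h3
      subst h1 h3
      rcases hdec with hlt | ⟨hpe, hg⟩
      · exact .left _ _ hlt
      rw [hpe]
      refine .right _ ?_
      rcases hg with hlt | ⟨hg, hQ⟩
      · refine .left _ _ ?_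
        obtain ⟨hle, v, hv⟩ := Pi.lt_def.1 hlt
        -- Outside `W` the new value of `g` is `⊤`, so the strict decrease takes place inside.
        have hvW : v ∈ W := by
          by_contra hvW
          have := h'.sound.outside v fun hv' => hvW (hW' ▸ Finset.mem_union_left _ hv')
          exact not_top_lt (this ▸ hv)
        refine Pi.lt_def.2 ⟨fun w => ?_, ⟨v, hvW⟩, ?_⟩
        · exact Subtype.coe_le_coe.1 ((hle w).trans_eq (h2 w))
        · exact Subtype.coe_lt_coe.1 (hv.trans_eq (h2 ⟨v, hvW⟩))
      · have : (fun v : W => (⟨st'.g v, hval v⟩ : I.values W)) = m2 :=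
          funext fun v => Subtype.ext ((congrFun hg v).trans (h2 v))
        rw [this]
        exact .right _ hQ
  exact key _ (st.pending.card, fun v => ⟨st.g v, h.sound.value v⟩, Multiset.card st.Q) st h rfl
    rfl (fun _ => rfl) rfl

/-- Ripple does not get stuck. -/
theorem exists_rippleStep {st : State X} (h : ¬ RippleDone st) : ∃ st', I.RippleStep st st' := by
  by_cases hQ : st.Q = 0
  · obtain ⟨s, hs⟩ := Finset.nonempty_iff_ne_empty.2 fun hp => h ⟨hQ, hp⟩
    by_cases hn : ∀ n ∈ I.nbrs (addNode s st).V s, (addNode s st).root n = none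
    · exact ⟨_, .inr ⟨hQ, s, hs, .inl ⟨hn, rfl⟩⟩⟩
    · push Not at hn
      obtain ⟨n, hn, hr⟩ := hn
      obtain ⟨m, hm, hmin⟩ := ((I.nbrs (addNode s st).V s).filter
        fun n => (addNode s st).root n ≠ none).exists_min_image (fun n => st.g n + I.dist s n)
        ⟨n, Finset.mem_filter.2 ⟨hn, hr⟩⟩
      rw [Finset.mem_filter] at hm
      exact ⟨_, .inr ⟨hQ, s, hs, .inr ⟨m, hm.1, hm.2, fun k hk hkr =>
        hmin k (Finset.mem_filter.2 ⟨hk, hkr⟩), rfl⟩⟩⟩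
  · obtain ⟨q, hq⟩ := Multiset.exists_mem_of_ne_zero hQ
    obtain ⟨⟨u, k⟩, hu, hmin⟩ := st.Q.toFinset.exists_min_image Prod.snd
      ⟨q, Multiset.mem_toFinset.2 hq⟩
    exact ⟨_, .inl ⟨u, k, (I.nbrs st.V u).toList, Multiset.mem_toFinset.1 hu,
      fun q hq => hmin q (Multiset.mem_toFinset.2 hq), Finset.nodup_toList _,
      fun n => Finset.mem_toList, rfl⟩⟩

end Ripple

/-! ### From relaxed edges to the minimum spanning tree. -/

section Main

open Classical

variable {X : Type*} [TopologicalSpace X] {I : Problem X} {st st' τ : State X} {B : Finset X}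

/-- Relaxation is propagated from the terminal end, where `g` is 0, back along the walk. -/
theorem Sound.g_le_walkCost (h : I.Sound st)
    (hle : ∀ u v, (I.roadmap st.V).Adj u v → st.g v ≤ st.g u + I.dist u v) {x y : X}
    (hy : y ∈ I.T) (p : (I.roadmap st.V).Walk x y) : st.g x ≤ I.walkCost p := by
  induction p with
  | nil => simp [(h.terminal _ hy).1]
  | cons hadj p ih =>
    rw [walkCost_cons, add_comm, I.dist_comm]
    exact (hle _ _ hadj.symm).trans (by gcongr; exact ih hy)

/-- At the end of Ripple, the ends of a walk of the roadmap that joins two terminals are connected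
by terminal pairs whose terminal costs do not exceed the cost of the walk. -/
theorem RippleInv.conn_of_walk (h : I.RippleInv st) (hQ : st.Q = 0) {t t' : X} (ht : t ∈ I.T)
    (ht' : t' ∈ I.T) (p : (I.roadmap st.V).Walk t t') :
    Conn ((termPairs I.T).filter fun e => st.costT e ≤ I.walkCost p) t t' := by
  have hnq : ∀ u, ¬ Queued st u := fun u ⟨k, hk⟩ => by simp [hQ] at hk
  have hle : ∀ u v, (I.roadmap st.V).Adj u v → st.g v ≤ st.g u + I.dist u v := fun u v huv =>
    (h.relaxed.le u v huv).resolve_left (hnq u)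
  -- Induction over suffixes of the walk: `α` is the cost of the part already traversed, and it also
  -- bounds `g` at the current node, whose root is `r`.
  have key : ∀ {x y : X} (p : (I.roadmap st.V).Walk x y) (α : ℝ≥0∞) (r : X), y ∈ I.T →
      st.g x ≤ α → α < ⊤ → st.root x = some r →
      Conn ((termPairs I.T).filter fun e => st.costT e ≤ α + I.walkCost p) r y := by
    intro x y p
    induction p with
    | nil =>
      intro α r hy _ _ hr
      rw [(h.sound.terminal _ hy).2, Option.some_inj] at hr
      exact hr ▸ Conn.refl _
    | @cons x z y hadj p ih =>
      intro α r hy hα hα' hr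
      have hd : I.dist x z < ⊤ := (roadmap_adj.1 hadj).2.2.2.trans_lt ENNReal.coe_lt_top
      have hgz : st.g z ≤ α + I.dist x z := (hle x z hadj).trans (by gcongr)
      have hα'' := ENNReal.add_lt_top.2 ⟨hα', hd⟩
      obtain ⟨r', hr'⟩ := h.sound.exists_root (hgz.trans_lt hα'')
      have hrest := ih _ r' hy hgz hα'' hr'
      rw [walkCost_cons, ← add_assoc]
      by_cases hrr : r = r'
      · exact hrr ▸ hrest
      · refine (Conn.of_mem (Finset.mem_filter.2 ⟨mem_termPairs.2
          ⟨(h.sound.root_some x r hr).1, (h.sound.root_some z r' hr').1, hrr⟩, ?_⟩)).trans hrest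
        -- The root changes from `x` to `z`: `g x` is bounded by the prefix and `g z` by the
        -- remaining walk.
        refine (((h.relaxed.cost x z r r' hadj hr hr' hrr).resolve_left (hnq x)).resolve_left
          (hnq z)).trans ?_
        gcongr
        exact h.sound.g_le_walkCost hle hy p
  have hterm := h.sound.terminal t ht
  simpa using key p 0 t ht' hterm.1.le ENNReal.zero_lt_top hterm.2

theorem h_le_metricCompletion_of_mem {V : Finset X} :
    ∀ e ∈ termPairs I.T, (I.h e : ℝ≥0∞) ≤ I.metricCompletion V e := fun _ he =>
  h_le_metricCompletion (Finset.mem_filter.1 he).2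

/-- UpdateTree only lowers terminal costs, so relaxed edges stay relaxed for the next iteration. -/
theorem RippleInv.updatePrune (h : I.RippleInv st) (hQ : st.Q = 0)
    (hst : I.UpdatePrune st st') : I.RippleInv st' := by
  obtain ⟨y, hy, rfl⟩ := hst
  obtain ⟨h1, h2, h3, -⟩ := h.sound.tree.updateTree hy isDist_metricCompletion h.sound.cost
    h_le_metricCompletion_of_mem
  have hnq : ∀ u, ¬ Queued st u := fun u ⟨k, hk⟩ => by simp [hQ] at hk
  exact ⟨{ h.sound with cost := h3, tree := h1.prune }, h.relaxed.le,
    fun u v a b huv ha hb hab => .inr (.inr ((h2 _).trans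
      (((h.relaxed.cost u v a b huv ha hb hab).resolve_left (hnq u)).resolve_left (hnq v))))⟩

theorem RippleInv.isMST (h : I.RippleInv st) (hQ : st.Q = 0) (hst : I.UpdatePrune st st')
    (hconn : ∀ t ∈ I.T, ∀ t' ∈ I.T, (I.roadmap st.V).Reachable t t') :
    IsMST I.T (I.metricCompletion st.V) st'.S ∧
      ∀ e ∈ st'.S, st'.costT e = I.metricCompletion st.V e := by
  obtain ⟨y, hy, rfl⟩ := hst
  obtain ⟨-, h2, h3, h4⟩ := h.sound.tree.updateTree hy isDist_metricCompletion h.sound.cost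
    h_le_metricCompletion_of_mem
  obtain ⟨htree, hset⟩ := h4 fun t ht t' ht' => by
    obtain ⟨p⟩ := hconn t ht t' ht'
    exact (h.conn_of_walk hQ ht ht' p).mono fun e he => by
      rw [Finset.mem_filter] at he ⊢
      exact ⟨he.1, he.2.trans_lt (walkCost_lt_top p)⟩
  refine isMST_of_bottleneck I.T_nonempty htree h3 fun u v huv f hf hsep => le_iInf fun p => ?_
  -- If `f` cost more than the walk `p`, the cheap pairs linking `u` and `v`, each replaced by its
  -- cheap connection in the tree, would avoid `f`.
  by_contra hlt
  have huv' := mem_termPairs.1 huv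
  refine hsep ((h.conn_of_walk hQ huv'.1 huv'.2.1 p).bind fun a b hab => ?_)
  rw [Finset.mem_filter] at hab
  refine (hset _ hab.1 a b rfl).mono fun f' hf' => ?_
  rw [Finset.mem_filter] at hf'
  refine Finset.mem_erase.2 ⟨fun heq => hlt ?_, hf'.1⟩
  exact heq ▸ hf'.2.trans ((h2 _).trans hab.2)

theorem RippleInv.load (h : I.RippleInv st) (hdone : RippleDone st) (hB : I.IsBatch B st) :
    I.RippleInv (load B st) :=
  ⟨{ h.sound with
      disjoint := hB.2
      value := fun v => values_mono (by simp [hdone.2, Problem.load]) (h.sound.value v) },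
    h.relaxed.le, h.relaxed.cost⟩

theorem rippleInv_init (I : Problem X) : I.RippleInv I.init := by
  have hg : ∀ v, v ∈ I.T → I.init.g v = 0 := fun v hv => by simp [init, hv]
  have hroot : ∀ v, v ∈ I.T → I.init.root v = some v := fun v hv => by simp [init, hv]
  have hroot' : ∀ v r, I.init.root v = some r → v = r ∧ v ∈ I.T := fun v r hv => by
    simp only [init, Option.ite_none_right_eq_some, Option.some_inj] at hv
    exact ⟨hv.2, hv.1⟩
  refine ⟨⟨subset_rfl, Finset.disjoint_empty_left _, fun v hv => ?_, fun v hv => ?_,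
    fun v r hv => ?_, fun t ht => ⟨hg t ht, hroot t ht⟩, fun v => ?_, fun e => ?_, ?_, ?_⟩, ?_, ?_⟩
  · exact if_neg hv
  · simp only [init, ite_eq_right_iff, reduceCtorEq, imp_false] at hv ⊢
    exact fun h => absurd h hv
  · obtain ⟨rfl, hvT⟩ := hroot' v r hv
    exact ⟨hvT, by simp [hg v hvT], by simp [isDist_metricCompletion.self]⟩
  · by_cases hv : v ∈ I.T
    · rw [hg v hv]
      exact zero_mem_values _
    · have : I.init.g v = ⊤ := if_neg hv
      rw [this]
      exact top_mem_values _
  · induction e with | _ u v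
    simp only [init]
    split_ifs with he
    · exact metricCompletion_le_dist he
    · exact le_top
  · exact ⟨Finset.empty_subset _, subset_rfl, .inl rfl, fun e he he' => absurd he he'⟩
  · intro q hq
    exact absurd hq (Multiset.notMem_zero q)
  · intro u v huv
    rw [hg v huv.symm.1]
    exact .inr zero_le
  · intro u v a b huv ha hb _
    obtain ⟨rfl, -⟩ := hroot' u a ha
    obtain ⟨rfl, -⟩ := hroot' v b hb
    refine .inr (.inr ?_)
    -- The initial queue is empty, so edges between terminals must be accounted for from the start;
    -- the initial terminal costs do this.
    have : I.init.costT s(u, v) = I.dist u v := if_pos huv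
    rw [this]
    exact le_add_right le_add_self

theorem Reachable.rippleInv (h : I.Reachable st) : I.RippleInv st ∧ RippleDone st := by
  induction h with
  | init => exact ⟨rippleInv_init I, rfl, rfl⟩
  | iterate _ hB hit ih =>
    obtain ⟨τ, hτ, hdone, hup⟩ := hit
    have hτi := ((ih.1.load ih.2 hB).reflTransGen hτ).1
    refine ⟨hτi.updatePrune hdone.1 hup, ?_⟩
    obtain ⟨y, -, rfl⟩ := hup
    exact hdone

end Main

end Problem

end ISTStar

open Classical in
theorem mainTheorem1 {X : Type*} [TopologicalSpace X] (I : ISTStar.Problem X)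
    (st : ISTStar.State X) (hst : I.Reachable st) (B : Finset X) (hB : I.IsBatch B st) :
    -- every execution of Ripple on the batch `B` is finite,
    Acc (fun b a => I.RippleStep a b) (ISTStar.Problem.load B st) ∧
    -- no execution of the iteration gets stuck,
    (∀ τ, Relation.ReflTransGen I.RippleStep (ISTStar.Problem.load B st) τ →
      (∃ τ', I.RippleStep τ τ') ∨
        (ISTStar.Problem.RippleDone τ ∧ ∃ st', I.UpdatePrune τ st')) ∧
    -- and every outcome contains a minimum spanning tree of the metric completion.
    (∀ st', I.Iteration B st st' →
      st'.V = st.V ∪ B ∧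
      ((∀ t ∈ I.T, ∀ t' ∈ I.T, (I.roadmap st'.V).Reachable t t') →
        ISTStar.IsMST I.T (I.metricCompletion st'.V) st'.S ∧
        ∀ e ∈ st'.S, st'.costT e = I.metricCompletion st'.V e)) := by
  obtain ⟨hinv, hdone⟩ := hst.rippleInv
  have hload := hinv.load hdone hB
  refine ⟨hload.acc, fun τ hτ => ?_, fun st' hit => ?_⟩
  · by_cases hτd : ISTStar.Problem.RippleDone τ
    · obtain ⟨y, hy⟩ := (hload.reflTransGen hτ).1.sound.tree.exists_updateTree
      exact .inr ⟨hτd, _, y, hy, rfl⟩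
    · exact .inl (ISTStar.Problem.exists_rippleStep hτd)
  · obtain ⟨τ, hτ, hτd, hup⟩ := hit
    obtain ⟨hτi, hV⟩ := hload.reflTransGen hτ
    have hV' : st'.V = τ.V := by
      obtain ⟨y, -, rfl⟩ := hup
      rfl
    rw [hτd.2, Finset.union_empty] at hV
    rw [hV']
    exact ⟨hV, hτi.isMST hτd.1 hup⟩
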